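/- All graphs are finite and simple. For graphs $H_1$ and $H_2$, let $r(H_1,H_2)$ be the smallest positive integer $N$ such that for every graph $F$ on $N$ vertices, $F$ contains $H_1$ as a subgraph or the complement $\overline{F}$ contains $H_2$ as a subgraph. Let $C_k$ denote the cycle on $k$ vertices. Let $k\ge 3$ be an odd integer and let $G$ be a connected graph with $n$ vertices and at most $\left(1+\frac{1}{117k^2}\right)n$ edges. If $n\ge 1833k^4$, then $$r(G,C_k)=2n-1.$$ -/

import Mathlib

/-- The Ramsey number `r(H₁, H₂)`: the smallest positive integer `N` such that every graph `F` on
`N` vertices contains `H₁` as a (not necessarily induced) subgraph, or its complement contains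
`H₂` as a subgraph. -/
noncomputable def ramseyNumber {V W : Type*} (H₁ : SimpleGraph V) (H₂ : SimpleGraph W) : ℕ :=
  sInf {N : ℕ | 0 < N ∧
    ∀ F : SimpleGraph (Fin N), H₁.IsContained F ∨ H₂.IsContained Fᶜ}

/-! Call the edges of the host `F` red and those of `Fᶜ` blue. For the lower bound, two red cliques
with at most `n - 1` vertices each are too small for a connected pattern, and blue is then
bipartite.

For the upper bound, blue has no `C_k` and the pattern has at most `n + l` edges, where `l` is `n /
(117 k²)` rounded down. Three facts carry the argument. First, a blue neighbourhood contains no blue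
path on `k - 1` vertices, so it is degenerate in blue and contains a red clique on at least a `1 /
(k - 2)` fraction of it (`NoCycleSeq.exists_degIn_lt`, `exists_clique_of_degenerate`). Second, a
part of the pattern with all degrees above `d ≥ 2` has at most `2l / (d - 1)` vertices
(`CutConnected.card_core_le`); it goes into a red clique and the other vertices follow greedily
(`exists_partialEmb_of_lists`). Third, a large pattern with few leaves has a path of `3k` edges with
inner vertices of degree two (`CutConnected.card_le_of_no_suspendedPath`). Bypassing one inner
vertex gives a smaller pattern. The image of the shortened path can be lengthened by a rotation,
unless the unused host vertices form a red clique, which then takes the whole pattern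
(`IsSuspendedPath.exists_partialEmb`).

Let `Δ` be the maximum blue degree, attained at `v`. If `0 < Δ ≤ (n - 1) / 2`, the greedy embedding
works with `d` equal to `(n - 1) / Δ` rounded down. If `(n - 1) / 2 < Δ < n`, all red degrees are at
least `n - 1`, so leaves can be removed and put back; leafless patterns are shortened until they fit
into the red clique. If `Δ ≥ n`, then `n` blue neighbours of `v` form a red clique (`k = 3`) or an
almost complete red graph (`k ≥ 5`). In the latter, patterns with few leaves are again shortened.
With many leaves, either enough vertices of red degree at least `n - 1` exist to carry the last
leaves, or most of the neighbourhood is a red clique `P` joined in blue to almost everything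
outside. Then the vertices with two blue neighbours in `P` form a red clique too, and either that
clique has `n` vertices or `P` extends by vertices that can host leaves. -/

section
open scoped Classical

variable {V W : Type*}

/-! ### Odd cycles forced by common neighbours -/

/-- The number of neighbours of `x` in `X`. -/
noncomputable def degIn (H : SimpleGraph V) (X : Finset V) (x : V) : ℕ :=
  (X.filter (fun y => H.Adj x y)).card

/-- The graph `B` has no cycle on `k` vertices, written with sequences. -/
def NoCycleSeq (B : SimpleGraph W) (k : ℕ) : Prop :=
  ∀ c : ℕ → W, Set.InjOn c (Set.Iio k) → (∀ i, i + 1 < k → B.Adj (c i) (c (i + 1))) →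
    ¬ B.Adj (c (k - 1)) (c 0)

lemma noCycleSeq_of_not_isContained {B : SimpleGraph W} {k : ℕ} (hk : 3 ≤ k)
    (h : ¬ (SimpleGraph.cycleGraph k).IsContained B) : NoCycleSeq B k := by
  intro c hc hadj hclose
  apply h
  obtain ⟨m, rfl⟩ : ∃ m, k = m + 1 := ⟨k - 1, by omega⟩
  have key : ∀ i j : Fin (m + 1), i - j = 1 → B.Adj (c j) (c i) := by
    intro i j hij
    have hi : i = 1 + j := sub_eq_iff_eq_add.1 hij
    by_cases hj : (j : ℕ) = m
    · have : (i : ℕ) = 0 := by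
        rw [hi, Fin.val_add, hj, Fin.val_one', Nat.mod_eq_of_lt (by omega : 1 < m + 1)]
        rw [Nat.add_comm, Nat.mod_self]
      rw [this, hj]
      simpa using hclose
    · have hj' : (j : ℕ) < m := by omega
      have : (i : ℕ) = j + 1 := by
        rw [hi, Fin.val_add, Fin.val_one', Nat.mod_eq_of_lt (by omega : 1 < m + 1),
          Nat.mod_eq_of_lt (by omega)]
        omega
      rw [this]
      exact hadj _ (by omega)
  refine ⟨⟨⟨fun i => c i, ?_⟩, ?_⟩⟩
  · intro a b hab
    rw [SimpleGraph.cycleGraph_adj'] at hab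
    have h1 : ∀ i j : Fin (m + 1), (i - j).val = 1 → i - j = 1 := by
      intro i j hij
      ext
      rw [hij, Fin.val_one', Nat.mod_eq_of_lt (by omega)]
    rcases hab with hab | hab
    · exact (key a b (h1 _ _ hab)).symm
    · exact key b a (h1 _ _ hab)
  · intro a b hab
    exact Fin.ext (hc a.2 b.2 hab)

lemma NoCycleSeq.card_lt_of_clique {B : SimpleGraph W} {k : ℕ} (hk : 3 ≤ k) (hB : NoCycleSeq B k)
    (A : Finset W) (hA : ∀ a ∈ A, ∀ b ∈ A, a ≠ b → B.Adj a b) : A.card < k := by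
  by_contra hcon
  push Not at hcon
  let e := A.equivFin.symm
  let c : ℕ → W := fun i => if h : i < A.card then (e ⟨i, h⟩ : W) else (e ⟨0, by omega⟩ : W)
  have hmem : ∀ i < A.card, c i ∈ A := by
    intro i hi
    simp only [c, dif_pos hi]
    exact Subtype.property _
  have hinj : ∀ i < A.card, ∀ j < A.card, c i = c j → i = j := by
    intro i hi j hj hij
    simp only [c, dif_pos hi, dif_pos hj] at hij
    have := e.injective (Subtype.ext hij)
    simpa using this
  refine hB c ?_ ?_ ?_
  · intro i hi j hj hij
    exact hinj i (lt_of_lt_of_le hi hcon) j (lt_of_lt_of_le hj hcon) hij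
  · intro i hi
    refine hA _ (hmem _ (by omega)) _ (hmem _ (by omega)) fun h => ?_
    have := hinj _ (by omega) _ (by omega) h
    omega
  · refine hA _ (hmem _ (by omega)) _ (hmem _ (by omega)) fun h => ?_
    have := hinj _ (by omega) _ (by omega) h
    omega

/-- Every other vertex lies in `A`, and consecutive ones are linked through fresh common neighbours
in `C`. Deleting a used vertex of `C` costs one common neighbour, matching the drop in `j`. -/
lemma exists_alternating_path (B : SimpleGraph W) (j : ℕ) (hj : 1 ≤ j) :
    ∀ (A C : Finset W), Disjoint A C → j + 1 ≤ A.card →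
    (∀ a ∈ A, ∀ a' ∈ A, j ≤ (C.filter (fun c => B.Adj a c ∧ B.Adj a' c)).card) →
    ∀ a ∈ A, ∀ a' ∈ A, a ≠ a' →
    ∃ c : ℕ → W, Set.InjOn c (Set.Iic (2 * j)) ∧ c 0 = a ∧ c (2 * j) = a' ∧
      (∀ i < 2 * j, B.Adj (c i) (c (i + 1))) ∧ ∀ i ≤ 2 * j, c i ∈ A ∪ C := by
  induction j, hj using Nat.le_induction with
  | base =>
    intro A C hd hA hcom a ha a' ha' hne
    obtain ⟨x, hx⟩ := Finset.card_pos.1 (hcom a ha a' ha')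
    rw [Finset.mem_filter] at hx
    have hxA : x ∉ A := fun h => Finset.disjoint_left.1 hd h hx.1
    refine ⟨fun i => if i = 0 then a else if i = 1 then x else a', ?_, by simp, by simp, ?_, ?_⟩
    · intro s hs t ht hst
      simp only [Set.mem_Iic] at hs ht
      have h1 : a ≠ x := fun h => hxA (h ▸ ha)
      have h2 : a' ≠ x := fun h => hxA (h ▸ ha')
      interval_cases s <;> interval_cases t <;> simp_all
    · intro i hi
      interval_cases i
      · simpa using hx.2.1
      · simpa using hx.2.2.symm
    · intro i hi
      interval_cases i <;> simp [ha, ha', hx.1]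
  | succ j hj ih =>
    intro A C hd hA hcom a ha a' ha' hne
    -- The path begins `a`, `x`, `b`; the rest runs from `b` to `a'` and avoids `a` and `x`.
    obtain ⟨b, hb⟩ : ((A.erase a).erase a').Nonempty := by
      rw [← Finset.card_pos, Finset.card_erase_of_mem (by simp [ha', hne.symm]),
        Finset.card_erase_of_mem ha]
      omega
    simp only [Finset.mem_erase] at hb
    obtain ⟨hba', hba, hbA⟩ := hb
    obtain ⟨x, hx⟩ := Finset.card_pos.1 (lt_of_lt_of_le (Nat.succ_pos j) (hcom a ha b hbA))
    rw [Finset.mem_filter] at hx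
    have hxA : x ∉ A := fun h => Finset.disjoint_left.1 hd h hx.1
    have haC : a ∉ C := Finset.disjoint_left.1 hd ha
    obtain ⟨c, hcinj, hc0, hcj, hcadj, hcmem⟩ := ih (A.erase a) (C.erase x)
      (hd.mono (Finset.erase_subset _ _) (Finset.erase_subset _ _))
      (by rw [Finset.card_erase_of_mem ha]; omega)
      (by
        intro s hs t ht
        have h1 := hcom s (Finset.mem_of_mem_erase hs) t (Finset.mem_of_mem_erase ht)
        rw [Finset.filter_erase]
        have := Finset.pred_card_le_card_erase (a := x)
          (s := C.filter (fun c => B.Adj s c ∧ B.Adj t c))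
        omega)
      b (by simp [hba, hbA]) a' (by simp [ha', hne.symm]) hba'
    have hnot : ∀ i ≤ 2 * j, c i ≠ a ∧ c i ≠ x := by
      intro i hi
      have := hcmem i hi
      simp only [Finset.mem_union, Finset.mem_erase] at this
      rcases this with h | h
      · exact ⟨h.1, fun h' => hxA (h' ▸ h.2)⟩
      · exact ⟨fun h' => haC (h' ▸ h.2), h.1⟩
    have hax : a ≠ x := fun h => hxA (h ▸ ha)
    refine ⟨fun i => if i = 0 then a else if i = 1 then x else c (i - 2), ?_, by simp, ?_, ?_, ?_⟩
    · intro s hs t ht hst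
      simp only [Set.mem_Iic] at hs ht
      simp only at hst
      split_ifs at hst with h1 h2 h3 h4 h5 h6 h7 h8
      all_goals first
        | omega
        | exact absurd hst hax
        | exact absurd hst hax.symm
        | exact absurd hst.symm (hnot _ (by omega)).1
        | exact absurd hst.symm (hnot _ (by omega)).2
        | exact absurd hst (hnot _ (by omega)).1
        | exact absurd hst (hnot _ (by omega)).2
        | (have := hcinj (show s - 2 ≤ 2 * j by omega) (show t - 2 ≤ 2 * j by omega) hst; omega)
    · have : 2 * (j + 1) - 2 = 2 * j := by omega
      simp [this, hcj]
    · intro i hi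
      rcases i with _ | _ | i
      · simpa using hx.2.1
      · simpa [hc0] using hx.2.2.symm
      · simpa using hcadj i (by omega)
    · intro i hi
      simp only
      split_ifs
      · simp [ha]
      · simp [hx.1]
      · have := hcmem (i - 2) (by omega)
        simp only [Finset.mem_union, Finset.mem_erase] at this ⊢
        tauto

/-- An edge inside `A` would close an alternating path with `k - 1` edges, an even number, into a
cycle on `k` vertices. -/
lemma NoCycleSeq.not_adj_of_common {B : SimpleGraph W} {k : ℕ} (hk : 3 ≤ k) (hodd : Odd k)
    (hB : NoCycleSeq B k) (A C : Finset W) (hd : Disjoint A C) (hA : k ≤ A.card)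
    (hcom : ∀ a ∈ A, ∀ a' ∈ A, k ≤ (C.filter (fun c => B.Adj a c ∧ B.Adj a' c)).card) :
    ∀ a ∈ A, ∀ a' ∈ A, ¬ B.Adj a a' := by
  intro a ha a' ha' hadj
  obtain ⟨j, rfl⟩ := hodd
  obtain ⟨c, hcinj, hc0, hcj, hcadj, -⟩ := exists_alternating_path B j (by omega) A C hd (by omega)
    (fun s hs t ht => le_trans (by omega) (hcom s hs t ht)) a ha a' ha' hadj.ne
  refine hB c ?_ (fun i hi => hcadj i (by omega)) ?_
  · exact hcinj.mono fun i hi => by simp only [Set.mem_Iio, Set.mem_Iic] at *; omega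
  · rw [hc0, show 2 * j + 1 - 1 = 2 * j by omega, hcj]
    exact hadj.symm

/-- Distinct neighbours `p`, `p'` of `x`, `x'` in `A` are joined by an alternating path on `k - 2`
vertices, which the edge between `x` and `x'` completes to a `C_k`. This path is nontrivial because
`k ≥ 5`. -/
lemma NoCycleSeq.not_adj_of_two_neighbors {B : SimpleGraph W} {k : ℕ} (hk : 5 ≤ k) (hodd : Odd k)
    (hB : NoCycleSeq B k) (A C : Finset W) (hd : Disjoint A C) (hA : k ≤ A.card)
    (hcom : ∀ a ∈ A, ∀ a' ∈ A, k ≤ (C.filter (fun c => B.Adj a c ∧ B.Adj a' c)).card)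
    {x x' : W} (hxA : x ∉ A) (hxA' : x' ∉ A) (hx : 2 ≤ degIn B A x) (hx' : 2 ≤ degIn B A x') :
    ¬ B.Adj x x' := by
  intro hadj
  obtain ⟨p, hp⟩ := Finset.card_pos.1 (lt_of_lt_of_le Nat.zero_lt_two hx)
  obtain ⟨p', hp', hne⟩ := Finset.exists_mem_ne (lt_of_lt_of_le Nat.one_lt_two hx') p
  rw [Finset.mem_filter] at hp hp'
  obtain ⟨j, rfl⟩ : ∃ j, k = 2 * j + 3 := by
    obtain ⟨i, rfl⟩ := hodd
    exact ⟨i - 1, by omega⟩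
  obtain ⟨c, hcinj, hc0, hcj, hcadj, hcmem⟩ := exists_alternating_path B j (by omega) A
    ((C.erase x).erase x')
    (hd.mono_right ((Finset.erase_subset _ _).trans (Finset.erase_subset _ _))) (by omega)
    (fun s hs t ht => by
      rw [Finset.filter_erase, Finset.filter_erase]
      have h1 := hcom s hs t ht
      have h2 := Finset.pred_card_le_card_erase (a := x)
          (s := C.filter (fun c => B.Adj s c ∧ B.Adj t c))
      have h3 := Finset.pred_card_le_card_erase (a := x')
          (s := (C.filter (fun c => B.Adj s c ∧ B.Adj t c)).erase x)
      omega) p hp.1 p' hp'.1 hne.symm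
  have hnot : ∀ i ≤ 2 * j, c i ≠ x ∧ c i ≠ x' := by
    intro i hi
    have := hcmem i hi
    simp only [Finset.mem_union, Finset.mem_erase] at this
    rcases this with h | h
    · exact ⟨fun h' => hxA (h' ▸ h), fun h' => hxA' (h' ▸ h)⟩
    · exact ⟨h.2.1, h.1⟩
  refine hB (fun i => if i ≤ 2 * j then c i else if i = 2 * j + 1 then x' else x) ?_ ?_ ?_
  · intro s hs t ht hst
    simp only [Set.mem_Iio] at hs ht
    simp only at hst
    split_ifs at hst with h1 h2 h3 h4 h5 h6 h7 h8
    all_goals first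
      | omega
      | exact absurd hst hadj.ne
      | exact absurd hst hadj.ne.symm
      | exact absurd hst.symm (hnot _ (by omega)).1
      | exact absurd hst.symm (hnot _ (by omega)).2
      | exact absurd hst (hnot _ (by omega)).1
      | exact absurd hst (hnot _ (by omega)).2
      | exact hcinj h1 h2 hst
  · intro i hi
    rcases lt_trichotomy i (2 * j) with h | h | h
    · simpa [h.le, Nat.succ_le_iff.2 h] using hcadj i h
    · subst h
      simpa [hcj] using hp'.2.symm
    · obtain rfl : i = 2 * j + 1 := by omega
      simpa using hadj.symm
  · simpa [hc0] using hp.2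

/-! ### Lengthening a red path with fixed ends -/

/-- The first `m + 1` terms of `x` form a path of `F`. -/
def IsPathSeq (F : SimpleGraph W) (x : ℕ → W) (m : ℕ) : Prop :=
  Set.InjOn x (Set.Iic m) ∧ ∀ i < m, F.Adj (x i) (x (i + 1))

/-- Inserting an outside vertex into a path by a rotation. -/
lemma IsPathSeq.insert_rotate {F : SimpleGraph W} {x : ℕ → W} {m : ℕ} (hx : IsPathSeq F x m)
    {u : W} (hu : ∀ i ≤ m, x i ≠ u) {i j : ℕ} (hij : i < j) (hjm : j < m)
    (hi : F.Adj u (x i)) (hj : F.Adj u (x j)) (hs : F.Adj (x (i + 1)) (x (j + 1))) :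
    ∃ y : ℕ → W, IsPathSeq F y (m + 1) ∧ y 0 = x 0 ∧ y (m + 1) = x m ∧
      ∀ t ≤ m + 1, y t = u ∨ ∃ s ≤ m, y t = x s := by
  -- The new path is `x 0, …, x i, u, x j, x (j - 1), …, x (i + 1), x (j + 1), …, x m`.
  refine ⟨fun t => if t ≤ i then x t else if t = i + 1 then u else
    if t ≤ j + 1 then x (j + i + 2 - t) else x (t - 1), ⟨?_, ?_⟩, by simp, ?_, ?_⟩
  · intro s hs t ht hst
    simp only [Set.mem_Iic] at hs ht
    simp only at hst
    have hX : ∀ a b, a ≤ m → b ≤ m → x a = x b → a = b := fun a b ha hb h => hx.1 ha hb h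
    split_ifs at hst
    all_goals first
      | omega
      | exact absurd hst (hu _ (by omega))
      | exact absurd hst.symm (hu _ (by omega))
      | (have := hX _ _ (by omega) (by omega) hst; omega)
  · intro t ht
    simp only
    rcases lt_trichotomy t i with h | h | h
    · rw [if_pos h.le, if_pos (by omega)]
      exact hx.2 t (by omega)
    · subst h
      rw [if_pos le_rfl, if_neg (by omega), if_pos rfl]
      exact hi.symm
    · rcases Nat.lt_or_ge t (i + 2) with h2 | h2
      · obtain rfl : t = i + 1 := by omega
        rw [if_neg (by omega), if_pos rfl, if_neg (by omega), if_neg (by omega), if_pos (by omega)]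
        rwa [show j + i + 2 - (i + 1 + 1) = j by omega]
      · rcases lt_trichotomy t (j + 1) with h3 | h3 | h3
        · rw [if_neg (by omega), if_neg (by omega), if_pos (by omega), if_neg (by omega),
            if_neg (by omega), if_pos (by omega),
            show j + i + 2 - t = (j + i + 2 - (t + 1)) + 1 by omega]
          exact (hx.2 _ (by omega)).symm
        · subst h3
          rw [if_neg (by omega), if_neg (by omega), if_pos (by omega), if_neg (by omega),
            if_neg (by omega), if_neg (by omega), show j + i + 2 - (j + 1) = i + 1 by omega]
          exact hs
        · rw [if_neg (by omega), if_neg (by omega), if_neg (by omega), if_neg (by omega),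
            if_neg (by omega), if_neg (by omega), show t + 1 - 1 = (t - 1) + 1 by omega]
          exact hx.2 _ (by omega)
  · simp only
    rw [if_neg (by omega), if_neg (by omega), if_neg (by omega), Nat.add_sub_cancel]
  · intro t ht
    simp only
    split_ifs
    · exact Or.inr ⟨t, by omega, rfl⟩
    · exact Or.inl rfl
    · exact Or.inr ⟨_, by omega, rfl⟩
    · exact Or.inr ⟨_, by omega, rfl⟩

/-- If no rotation is possible, the successors of the red neighbours of any `u ∈ U` form a blue
clique, so there are fewer than `k` of them. Any two vertices of `U` then share at least `k` blue
neighbours on the path, which forbids blue edges inside `U`. -/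
lemma IsPathSeq.lengthen {F : SimpleGraph W} {k : ℕ} (hk : 3 ≤ k) (hodd : Odd k)
    (hB : NoCycleSeq Fᶜ k) {x : ℕ → W} {m : ℕ} (hx : IsPathSeq F x m) (hm : 3 * k ≤ m + 1)
    (U : Finset W) (hU : ∀ i ≤ m, x i ∉ U) (hUk : k ≤ U.card) :
    (∀ u ∈ U, ∀ u' ∈ U, u ≠ u' → F.Adj u u') ∨
    ∃ y : ℕ → W, IsPathSeq F y (m + 1) ∧ y 0 = x 0 ∧ y (m + 1) = x m ∧
      ∀ t ≤ m + 1, y t ∈ U ∨ ∃ s ≤ m, y t = x s := by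
  by_cases hrot : ∃ u ∈ U, ∃ i j, i < j ∧ j < m ∧ F.Adj u (x i) ∧ F.Adj u (x j) ∧
      F.Adj (x (i + 1)) (x (j + 1))
  · right
    obtain ⟨u, hu, i, j, hij, hjm, h1, h2, h3⟩ := hrot
    obtain ⟨y, hy, hy0, hym, hmem⟩ := hx.insert_rotate
      (fun t ht h => hU t ht (h ▸ hu)) hij hjm h1 h2 h3
    refine ⟨y, hy, hy0, hym, fun t ht => ?_⟩
    rcases hmem t ht with h | h
    · exact Or.inl (h ▸ hu)
    · exact Or.inr h
  · left
    push Not at hrot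
    have hX : ∀ a b, a ≤ m → b ≤ m → x a = x b → a = b := fun a b ha hb h => hx.1 ha hb h
    have hred : ∀ u ∈ U, ((Finset.range m).filter (fun i => F.Adj u (x i))).card < k := by
      intro u hu
      have hcl := hB.card_lt_of_clique hk
        (((Finset.range m).filter (fun i => F.Adj u (x i))).image (fun i => x (i + 1))) (by
          intro a ha b hb hab
          simp only [Finset.mem_image, Finset.mem_filter, Finset.mem_range] at ha hb
          obtain ⟨i, ⟨him, hi⟩, rfl⟩ := ha
          obtain ⟨j, ⟨hjm, hj⟩, rfl⟩ := hb
          rw [SimpleGraph.compl_adj]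
          refine ⟨hab, fun hadj => ?_⟩
          rcases lt_trichotomy i j with h | h | h
          · exact hrot u hu i j h hjm hi hj hadj
          · exact hab (by rw [h])
          · exact hrot u hu j i h him hj hi hadj.symm)
      rwa [Finset.card_image_of_injOn] at hcl
      intro i hi j hj hij
      simp only [Finset.coe_filter, Finset.mem_range, Set.mem_ofPred_eq] at hi hj
      have := hX _ _ (by omega) (by omega) hij
      omega
    have hblue := hB.not_adj_of_common hk hodd U ((Finset.range m).image x)
      (by
        rw [Finset.disjoint_right]
        intro a ha
        simp only [Finset.mem_image, Finset.mem_range] at ha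
        obtain ⟨i, hi, rfl⟩ := ha
        exact hU i hi.le) hUk
      (by
        intro u hu u' hu'
        have hsub : (((Finset.range m) \ ((Finset.range m).filter (fun i => F.Adj u (x i)))) \
            ((Finset.range m).filter (fun i => F.Adj u' (x i)))).image x ⊆
            ((Finset.range m).image x).filter (fun c => Fᶜ.Adj u c ∧ Fᶜ.Adj u' c) := by
          intro a ha
          simp only [Finset.mem_image, Finset.mem_sdiff, Finset.mem_filter, Finset.mem_range] at ha
          obtain ⟨i, ⟨⟨hi, h1⟩, h2⟩, rfl⟩ := ha
          simp only [Finset.mem_image, Finset.mem_filter, Finset.mem_range, SimpleGraph.compl_adj]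
          refine ⟨⟨i, hi, rfl⟩, ⟨fun h => hU i hi.le (h ▸ hu), by tauto⟩,
            fun h => hU i hi.le (h ▸ hu'), by tauto⟩
        refine le_trans ?_ ((Finset.card_le_card hsub).trans_eq (by congr))
        rw [Finset.card_image_of_injOn]
        · have h1 := Finset.le_card_sdiff ((Finset.range m).filter (fun i => F.Adj u (x i)))
            (Finset.range m)
          have h2 := Finset.le_card_sdiff ((Finset.range m).filter (fun i => F.Adj u' (x i)))
            ((Finset.range m) \ ((Finset.range m).filter (fun i => F.Adj u (x i))))
          have h3 := hred u hu
          have h4 := hred u' hu'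
          rw [Finset.card_range] at h1
          omega
        · intro i hi j hj hij
          simp only [Finset.coe_sdiff, Set.mem_sdiff, Finset.mem_coe, Finset.mem_range] at hi hj
          exact hX _ _ hi.1.1.le hj.1.1.le hij)
    intro u hu u' hu' hne
    by_contra hcon
    exact hblue u hu u' hu' ((SimpleGraph.compl_adj _ _ _).2 ⟨hne, hcon⟩)

/-! ### Sparse blue neighbourhoods and their red cliques -/

/-- A graph of minimum degree at least `d` has a path on `d + 1` vertices. -/
lemma exists_pathSeq_of_degIn (B : SimpleGraph W) (A : Finset W) (hA : A.Nonempty) (d : ℕ)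
    (hd : ∀ x ∈ A, d ≤ degIn B A x) (j : ℕ) (hj : j ≤ d) :
    ∃ c : ℕ → W, IsPathSeq B c j ∧ ∀ i ≤ j, c i ∈ A := by
  induction j with
  | zero =>
    obtain ⟨a, ha⟩ := hA
    refine ⟨fun _ => a, ⟨?_, by simp⟩, fun _ _ => ha⟩
    intro s hs t ht _
    simp only [Set.mem_Iic] at hs ht
    omega
  | succ j ih =>
    obtain ⟨c, ⟨hinj, hadj⟩, hmem⟩ := ih (by omega)
    have hcard : ((Finset.range j).image c).card < (A.filter (fun y => B.Adj (c j) y)).card := by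
      have h1 : ((Finset.range j).image c).card ≤ j := by
        simpa using Finset.card_image_le (s := Finset.range j) (f := c)
      have h2 := hd (c j) (hmem j le_rfl)
      simp only [degIn] at h2
      omega
    obtain ⟨y, hy, hyn⟩ := Finset.exists_mem_notMem_of_card_lt_card hcard
    rw [Finset.mem_filter] at hy
    have hyc : ∀ i ≤ j, c i ≠ y := by
      intro i hi h
      rcases Nat.lt_or_ge i j with h1 | h1
      · exact hyn (Finset.mem_image.2 ⟨i, Finset.mem_range.2 h1, h⟩)
      · obtain rfl : i = j := by omega
        exact hy.2.ne h
    refine ⟨fun i => if i ≤ j then c i else y, ⟨?_, ?_⟩, ?_⟩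
    · intro s hs t ht hst
      simp only [Set.mem_Iic] at hs ht
      simp only at hst
      split_ifs at hst with h1 h2 h2
      · exact hinj h1 h2 hst
      · exact absurd hst (hyc _ h1)
      · exact absurd hst.symm (hyc _ h2)
      · omega
    · intro i hi
      rcases Nat.lt_or_ge i j with h1 | h1
      · simpa [h1.le, Nat.succ_le_iff.2 h1] using hadj i h1
      · obtain rfl : i = j := by omega
        simpa using hy.2
    · intro i hi
      simp only
      split_ifs with h
      · exact hmem i h
      · exact hy.1

/-- Otherwise `A` contains a path on `k - 1` vertices, and `v` closes it into a cycle on `k`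
vertices. -/
lemma NoCycleSeq.exists_degIn_lt {B : SimpleGraph W} {k : ℕ} (hk : 3 ≤ k) (hB : NoCycleSeq B k)
    {v : W} {A : Finset W} (hv : ∀ a ∈ A, B.Adj v a) (hA : A.Nonempty) :
    ∃ x ∈ A, degIn B A x < k - 2 := by
  by_contra hcon
  push Not at hcon
  obtain ⟨c, ⟨hinj, hadj⟩, hmem⟩ := exists_pathSeq_of_degIn B A hA (k - 2) hcon (k - 2) le_rfl
  have hvc : ∀ i ≤ k - 2, c i ≠ v := fun i hi h => (hv _ (hmem i hi)).ne h.symm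
  refine hB (fun i => if i ≤ k - 2 then c i else v) ?_ ?_ ?_
  · intro s hs t ht hst
    simp only [Set.mem_Iio] at hs ht
    simp only at hst
    split_ifs at hst with h1 h2 h2
    · exact hinj h1 h2 hst
    · exact absurd hst (hvc _ h1)
    · exact absurd hst.symm (hvc _ h2)
    · omega
  · intro i hi
    rcases Nat.lt_or_ge i (k - 2) with h1 | h1
    · simpa [h1.le, Nat.succ_le_iff.2 h1] using hadj i h1
    · obtain rfl : i = k - 2 := by omega
      simpa using (hv _ (hmem _ le_rfl)).symm
  · have : ¬ (k - 1 ≤ k - 2) := by omega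
    simpa [this] using hv _ (hmem 0 (by omega))

lemma sum_degIn_erase (H : SimpleGraph V) (X : Finset V) {x : V} (hx : x ∈ X) :
    ∑ y ∈ X, degIn H X y = ∑ y ∈ X.erase x, degIn H (X.erase x) y + 2 * degIn H X x := by
  have h1 : ∀ y ∈ X.erase x, degIn H X y = degIn H (X.erase x) y + if H.Adj x y then 1 else 0 := by
    intro y hy
    simp only [degIn]
    rw [Finset.filter_erase]
    split_ifs with h
    · rw [Finset.card_erase_add_one]
      exact Finset.mem_filter.2 ⟨hx, h.symm⟩
    · rw [Finset.erase_eq_of_notMem, Nat.add_zero]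
      exact fun h' => h (Finset.mem_filter.1 h').2.symm
  rw [← Finset.add_sum_erase X _ hx, Finset.sum_congr rfl h1, Finset.sum_add_distrib]
  have h2 : ∑ y ∈ X.erase x, (if H.Adj x y then 1 else 0) = degIn H X x := by
    rw [← Finset.card_filter, Finset.filter_erase, Finset.erase_eq_of_notMem]
    · rfl
    · simp
  omega

lemma exists_clique_of_degenerate (F : SimpleGraph W) (d : ℕ) (A : Finset W)
    (hdeg : ∀ A' ⊆ A, A'.Nonempty → ∃ x ∈ A', degIn Fᶜ A' x < d) :
    ∃ K ⊆ A, A.card ≤ d * K.card ∧ ∀ a ∈ K, ∀ b ∈ K, a ≠ b → F.Adj a b := by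
  induction A using Finset.strongInduction with
  | H A ih =>
    rcases A.eq_empty_or_nonempty with rfl | hA
    · exact ⟨∅, by simp, by simp, by simp⟩
    obtain ⟨x, hx, hxd⟩ := hdeg A subset_rfl hA
    -- Restricting to the red neighbours of `x` discards only `x` and its at most `d - 1` blue
    -- neighbours, so each clique vertex costs at most `d` vertices of `A`.
    have hsub : (A.erase x).filter (fun y => F.Adj x y) ⊂ A :=
      lt_of_le_of_lt (Finset.filter_subset _ _) (Finset.erase_ssubset hx)
    obtain ⟨K, hKA, hcard, hK⟩ := ih _ hsub fun A' hA' => hdeg A' (hA'.trans hsub.subset)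
    have hxK : x ∉ K := fun h => by simpa using hKA h
    refine ⟨insert x K, ?_, ?_, ?_⟩
    · exact Finset.insert_subset hx (hKA.trans hsub.subset)
    · rw [Finset.card_insert_of_notMem hxK, Nat.mul_succ]
      have h1 : (A.erase x).card + 1 = A.card := Finset.card_erase_add_one hx
      have h2 := Finset.card_filter_add_card_filter_not (s := A.erase x) (fun y => F.Adj x y)
      have h3 : ((A.erase x).filter (fun y => ¬ F.Adj x y)).card ≤ degIn Fᶜ A x := by
        refine Finset.card_le_card fun y hy => ?_
        simp only [Finset.mem_filter, Finset.mem_erase, SimpleGraph.compl_adj] at hy ⊢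
        exact ⟨hy.1.2, fun h => hy.1.1 h.symm, hy.2⟩
      omega
    · intro a ha b hb hab
      rw [Finset.mem_insert] at ha hb
      rcases ha with rfl | ha <;> rcases hb with rfl | hb
      · exact absurd rfl hab
      · exact (Finset.mem_filter.1 (hKA hb)).2
      · exact (Finset.mem_filter.1 (hKA ha)).2.symm
      · exact hK a ha b hb hab

lemma sum_degIn_le_of_degenerate (B : SimpleGraph W) (d : ℕ) (A : Finset W)
    (hdeg : ∀ A' ⊆ A, A'.Nonempty → ∃ x ∈ A', degIn B A' x ≤ d) :
    ∑ x ∈ A, degIn B A x ≤ 2 * d * A.card := by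
  induction A using Finset.strongInduction with
  | H A ih =>
    rcases A.eq_empty_or_nonempty with rfl | hA
    · simp
    obtain ⟨x, hx, hxd⟩ := hdeg A subset_rfl hA
    have h1 := ih _ (Finset.erase_ssubset hx) fun A' hA' => hdeg A' (hA'.trans (A.erase_subset x))
    rw [sum_degIn_erase B A hx, ← Finset.card_erase_add_one hx]
    nlinarith

/-! ### Partial embeddings and greedy extension -/

/-- `f` embeds the subgraph of `H` induced on `X` into `F`. -/
def PartialEmb (H : SimpleGraph V) (F : SimpleGraph W) (X : Finset V) (f : V → W) : Prop :=
  Set.InjOn f X ∧ ∀ a ∈ X, ∀ b ∈ X, H.Adj a b → F.Adj (f a) (f b)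

/-- Every nonempty proper subset of `X` sends an edge of `H` to the rest of `X`. -/
def CutConnected (H : SimpleGraph V) (X : Finset V) : Prop :=
  ∀ A ⊆ X, A.Nonempty → A ≠ X → ∃ a ∈ A, ∃ b ∈ X, b ∉ A ∧ H.Adj a b

lemma exists_partialEmb_of_clique [Nonempty W] (H : SimpleGraph V) (F : SimpleGraph W)
    {X : Finset V} {K : Finset W} (hK : ∀ a ∈ K, ∀ b ∈ K, a ≠ b → F.Adj a b)
    (hcard : X.card ≤ K.card) : ∃ f, PartialEmb H F X f ∧ ∀ x ∈ X, f x ∈ K := by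
  obtain ⟨e⟩ : Nonempty (X ↪ K) := Function.Embedding.nonempty_of_card_le (by simpa using hcard)
  let f : V → W := fun x => if h : x ∈ X then (e ⟨x, h⟩ : W) else Classical.arbitrary W
  have hinj : Set.InjOn f X := by
    intro a ha b hb hab
    simp only [Finset.mem_coe] at ha hb
    simp only [f, dif_pos ha, dif_pos hb] at hab
    simpa using e.injective (Subtype.ext hab)
  have hmem : ∀ x ∈ X, f x ∈ K := by
    intro x hx
    simp only [f, dif_pos hx]
    exact Subtype.property _
  exact ⟨f, ⟨hinj, fun a ha b hb hab => hK _ (hmem a ha) _ (hmem b hb)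
    fun h => hab.ne (hinj ha hb h)⟩, hmem⟩

lemma PartialEmb.insert {H : SimpleGraph V} {F : SimpleGraph W} {X : Finset V} {f : V → W}
    (hf : PartialEmb H F X f) {x : V} (hx : x ∉ X) {u : W} (hu : u ∉ X.image f)
    (hadj : ∀ y ∈ X, H.Adj x y → F.Adj u (f y)) :
    PartialEmb H F (insert x X) (Function.update f x u) := by
  have hne : ∀ y ∈ X, y ≠ x := fun y hy h => hx (h ▸ hy)
  have hval : ∀ y ∈ X, Function.update f x u y = f y := fun y hy =>
    Function.update_of_ne (hne y hy) _ _
  have huf : ∀ y ∈ X, f y ≠ u := fun y hy h => hu (Finset.mem_image.2 ⟨y, hy, h⟩)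
  constructor
  · intro a ha b hb hab
    simp only [Finset.coe_insert, Set.mem_insert_iff, Finset.mem_coe] at ha hb
    rcases ha with rfl | ha <;> rcases hb with rfl | hb
    · rfl
    · rw [Function.update_self, hval b hb] at hab
      exact absurd hab.symm (huf b hb)
    · rw [Function.update_self, hval a ha] at hab
      exact absurd hab (huf a ha)
    · rw [hval a ha, hval b hb] at hab
      exact hf.1 ha hb hab
  · intro a ha b hb hab
    rw [Finset.mem_insert] at ha hb
    rcases ha with rfl | ha <;> rcases hb with rfl | hb
    · exact absurd rfl hab.ne
    · rw [Function.update_self, hval b hb]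
      exact hadj b hb hab
    · rw [Function.update_self, hval a ha]
      exact (hadj a ha hab.symm).symm
    · rw [hval a ha, hval b hb]
      exact hf.2 a ha b hb hab

/-- Vertices of degree at most `d` are stripped off one by one; the remaining core goes into `K`,
which lies in every list. When a vertex returns, its at most `d` neighbours each exclude at most `Δ`
candidates, and `hcount` leaves a free one. The lists let some pattern vertices be reserved for
special host vertices. -/
lemma exists_partialEmb_of_lists [Nonempty W] (H : SimpleGraph V) (F : SimpleGraph W) (d Δ : ℕ)
    (A : V → Finset W) {K : Finset W} (hK : ∀ a ∈ K, ∀ b ∈ K, a ≠ b → F.Adj a b) (X : Finset V)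
    (hKA : ∀ x ∈ X, K ⊆ A x)
    (hcore : ∀ X' ⊆ X, (∀ x ∈ X', d < degIn H X' x) → X'.card ≤ K.card)
    (hΔ : ∀ x ∈ X, ∀ y ∈ X, ∀ u ∈ A x, degIn Fᶜ (A y) u ≤ Δ)
    (hcount : ∀ X' ⊆ X, ∀ x ∈ X, x ∉ X' → ∀ f, PartialEmb H F X' f → (∀ y ∈ X', f y ∈ A y) →
      ((X'.image f) ∩ A x).card + d * Δ < (A x).card) :
    ∃ f, PartialEmb H F X f ∧ ∀ x ∈ X, f x ∈ A x := by
  induction X using Finset.strongInduction with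
  | H X ih =>
    by_cases hmin : ∀ x ∈ X, d < degIn H X x
    · obtain ⟨f, hf, hfK⟩ := exists_partialEmb_of_clique H F hK (hcore X subset_rfl hmin)
      exact ⟨f, hf, fun x hx => hKA x hx (hfK x hx)⟩
    push Not at hmin
    obtain ⟨x, hx, hxd⟩ := hmin
    have hsub := X.erase_subset x
    obtain ⟨f, hf, hfA⟩ := ih _ (Finset.erase_ssubset hx) (fun y hy => hKA y (hsub hy))
      (fun X' hX' => hcore X' (hX'.trans hsub))
      (fun y hy z hz => hΔ y (hsub hy) z (hsub hz))
      (fun X' hX' y hy => hcount X' (hX'.trans hsub) y (hsub hy))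
    have h1 := hcount (X.erase x) hsub x hx (Finset.notMem_erase x X) f hf hfA
    set bad := (X.filter (fun y => H.Adj x y)).biUnion
      (fun y => (A x).filter (fun w => Fᶜ.Adj (f y) w)) with hbad
    have h2 : bad.card ≤ d * Δ := by
      refine (Finset.card_biUnion_le_card_mul _ _ Δ ?_).trans (Nat.mul_le_mul_right _ hxd)
      intro y hy
      rw [Finset.mem_filter] at hy
      have hyX : y ∈ X.erase x := Finset.mem_erase.2 ⟨hy.2.ne.symm, hy.1⟩
      refine le_of_eq_of_le ?_ (hΔ y hy.1 x hx (f y) (hfA y hyX))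
      simp only [degIn]
      congr
    obtain ⟨u, huA, hu⟩ := Finset.exists_mem_notMem_of_card_lt_card
      (lt_of_le_of_lt ((Finset.card_union_le _ bad).trans (Nat.add_le_add_left h2 _)) h1)
    simp only [Finset.mem_union, Finset.mem_inter, not_or, not_and] at hu
    have hu1 : u ∉ (X.erase x).image f := fun h => hu.1 h huA
    refine ⟨Function.update f x u, ?_, ?_⟩
    · rw [← Finset.insert_erase hx]
      refine hf.insert (Finset.notMem_erase x X) hu1 fun y hy hxy => ?_
      by_contra hcon
      refine hu.2 (Finset.mem_biUnion.2 ⟨y, Finset.mem_filter.2 ⟨hsub hy, hxy⟩,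
        Finset.mem_filter.2 ⟨huA, (SimpleGraph.compl_adj _ _ _).2 ⟨fun h => ?_, fun h => ?_⟩⟩⟩)
      · exact hu1 (Finset.mem_image.2 ⟨y, hy, h⟩)
      · exact hcon h.symm
    · intro y hy
      by_cases hyx : y = x
      · subst hyx
        rwa [Function.update_self]
      · rw [Function.update_of_ne hyx]
        exact hfA y (Finset.mem_erase.2 ⟨hyx, hy⟩)

/-- The vertices of `L` are attached one at a time. The `+ 1` in `hdeg` is available because the
image of the parent is occupied but is not its own neighbour. -/
lemma PartialEmb.add_leaves [Fintype W] {H : SimpleGraph V} {F : SimpleGraph W} {X : Finset V}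
    {f : V → W} (hf : PartialEmb H F X f) (par : V → V) (L : Finset V) (hd : Disjoint X L)
    (hpar : ∀ x ∈ L, par x ∈ X ∧ ∀ y ∈ X ∪ L, H.Adj x y → y = par x)
    (hdeg : ∀ x ∈ L, X.card + L.card ≤ degIn F Finset.univ (f (par x)) + 1) :
    ∃ g, PartialEmb H F (X ∪ L) g ∧ ∀ x ∈ X, g x = f x := by
  induction L using Finset.induction_on with
  | empty => exact ⟨f, by simpa using hf, fun _ _ => rfl⟩
  | insert x L hx ih =>
    obtain ⟨g, hg, hgf⟩ := ih (hd.mono_right (Finset.subset_insert x L))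
      (fun y hy => ⟨(hpar y (Finset.mem_insert_of_mem hy)).1, fun z hz =>
        (hpar y (Finset.mem_insert_of_mem hy)).2 z
          (Finset.union_subset_union_right (Finset.subset_insert x L) hz)⟩)
      (fun y hy => by
        have := hdeg y (Finset.mem_insert_of_mem hy)
        rw [Finset.card_insert_of_notMem hx] at this
        omega)
    obtain ⟨hpX, hpu⟩ := hpar x (Finset.mem_insert_self x L)
    have hxX : x ∉ X := Finset.disjoint_right.1 hd (Finset.mem_insert_self x L)
    have hcard := hdeg x (Finset.mem_insert_self x L)
    rw [Finset.card_insert_of_notMem hx] at hcard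
    have hlt : (((X ∪ L).image g).erase (f (par x))).card <
        (Finset.univ.filter (fun y => F.Adj (f (par x)) y)).card := by
      have h1 : f (par x) ∈ (X ∪ L).image g :=
        Finset.mem_image.2 ⟨par x, Finset.mem_union_left _ hpX, hgf _ hpX⟩
      have h2 := Finset.card_erase_add_one h1
      have h3 := (Finset.card_image_le (s := X ∪ L) (f := g)).trans (Finset.card_union_le X L)
      simp only [degIn] at hcard
      omega
    obtain ⟨u, hu, hun⟩ := Finset.exists_mem_notMem_of_card_lt_card hlt
    rw [Finset.mem_filter] at hu
    have hun' : u ∉ (X ∪ L).image g := fun h =>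
      hun (Finset.mem_erase.2 ⟨hu.2.ne.symm, h⟩)
    have hxXL : x ∉ X ∪ L := by simp [hxX, hx]
    refine ⟨Function.update g x u, ?_, ?_⟩
    · rw [Finset.union_insert]
      refine hg.insert hxXL hun' fun y hy hxy => ?_
      rw [hpu y (Finset.union_subset_union_right (Finset.subset_insert x L) hy) hxy, hgf _ hpX]
      exact hu.2.symm
    · intro y hy
      rw [Function.update_of_ne (by rintro rfl; exact hxX hy), hgf y hy]

/-! ### Edge excess, cores and leaves of sparse connected graphs -/

/-- Growing `X'` to `X` one vertex at a time across the cut adds at least one edge per vertex, so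
the excess of edges over vertices never decreases. -/
lemma CutConnected.sum_degIn_le {H : SimpleGraph V} {X : Finset V} (hX : CutConnected H X) {l : ℕ}
    (hsum : ∑ x ∈ X, degIn H X x ≤ 2 * (X.card + l)) (X' : Finset V) (hX' : X' ⊆ X) :
    ∑ x ∈ X', degIn H X' x ≤ 2 * (X'.card + l) := by
  induction hn : X.card - X'.card generalizing X' with
  | zero =>
    rw [Finset.eq_of_subset_of_card_le hX' (by omega)]
    exact hsum
  | succ n ih =>
    rcases X'.eq_empty_or_nonempty with rfl | hne
    · simp
    obtain ⟨a, ha, b, hb, hbX', hab⟩ := hX X' hX' hne (fun h => by rw [h] at hn; omega)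
    have h1 := ih (insert b X') (Finset.insert_subset hb hX')
      (by rw [Finset.card_insert_of_notMem hbX']; omega)
    rw [sum_degIn_erase H _ (Finset.mem_insert_self b X'), Finset.erase_insert hbX',
      Finset.card_insert_of_notMem hbX'] at h1
    have h2 : 0 < degIn H (insert b X') b :=
      Finset.card_pos.2 ⟨a, Finset.mem_filter.2 ⟨Finset.mem_insert_of_mem ha, hab.symm⟩⟩
    omega

lemma CutConnected.card_core_le {H : SimpleGraph V} {X : Finset V} (hX : CutConnected H X) {l : ℕ}
    (hsum : ∑ x ∈ X, degIn H X x ≤ 2 * (X.card + l)) {d : ℕ} (X' : Finset V) (hX' : X' ⊆ X)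
    (hmin : ∀ x ∈ X', d < degIn H X' x) : (d - 1) * X'.card ≤ 2 * l := by
  have h1 := hX.sum_degIn_le hsum X' hX'
  have h2 : X'.card * (d + 1) ≤ ∑ x ∈ X', degIn H X' x := by
    simpa using Finset.card_nsmul_le_sum X' (degIn H X') (d + 1) hmin
  rcases d with _ | d
  · simp
  · simp only [Nat.add_sub_cancel]
    nlinarith

lemma CutConnected.degIn_pos {H : SimpleGraph V} {X : Finset V} (hX : CutConnected H X)
    (hcard : 2 ≤ X.card) {x : V} (hx : x ∈ X) : 0 < degIn H X x := by
  obtain ⟨a, ha, b, hb, -, hab⟩ := hX {x} (by simpa using hx) (by simp)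
    (fun h => by rw [← h] at hcard; simp at hcard)
  rw [Finset.mem_singleton] at ha
  subst ha
  exact Finset.card_pos.2 ⟨b, Finset.mem_filter.2 ⟨hb, hab⟩⟩

lemma exists_unique_neighbor {H : SimpleGraph V} {X : Finset V} {x : V} (hx : degIn H X x = 1) :
    ∃ p ∈ X, H.Adj x p ∧ ∀ y ∈ X, H.Adj x y → y = p := by
  obtain ⟨p, hp⟩ := Finset.card_eq_one.1 hx
  have hmem : ∀ y, y ∈ X.filter (fun y => H.Adj x y) ↔ y = p := by simp [hp]
  have hp' := Finset.mem_filter.1 ((hmem p).2 rfl)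
  exact ⟨p, hp'.1, hp'.2, fun y hy hxy => (hmem y).1 (Finset.mem_filter.2 ⟨hy, hxy⟩)⟩

/-- A cut of the smaller set extends to one of `X` by putting the leaf on the side of its neighbour,
so the crossing edge avoids the leaf. -/
lemma CutConnected.erase_leaf {H : SimpleGraph V} {X : Finset V} (hX : CutConnected H X) {x : V}
    (hxX : x ∈ X) (hx : degIn H X x = 1) : CutConnected H (X.erase x) := by
  obtain ⟨p, hpX, hxp, hp⟩ := exists_unique_neighbor hx
  intro A hA hne hneX
  have hxA : x ∉ A := fun h => by simpa using hA h
  have hAX : A ⊆ X := hA.trans (X.erase_subset x)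
  by_cases hpA : p ∈ A
  · obtain ⟨a, ha, b, hb, hbA, hab⟩ := hX (insert x A) (Finset.insert_subset hxX hAX) (by simp)
      (fun h => hneX (by rw [← h, Finset.erase_insert hxA]))
    rw [Finset.mem_insert, not_or] at hbA
    rw [Finset.mem_insert] at ha
    rcases ha with rfl | ha
    · exact absurd (hp b hb hab ▸ hpA) hbA.2
    · exact ⟨a, ha, b, Finset.mem_erase.2 ⟨hbA.1, hb⟩, hbA.2, hab⟩
  · obtain ⟨a, ha, b, hb, hbA, hab⟩ := hX A hAX hne (fun h => hxA (h ▸ hxX))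
    refine ⟨a, ha, b, Finset.mem_erase.2 ⟨?_, hb⟩, hbA, hab⟩
    rintro rfl
    exact hpA (hp a (hAX ha) hab.symm ▸ ha)

/-! ### Suspended paths and their shortening -/

/-- `p` is a path in `X` with `q + 1` vertices whose inner vertices have degree two. -/
def IsSuspendedPath (H : SimpleGraph V) (X : Finset V) (p : ℕ → V) (q : ℕ) : Prop :=
  IsPathSeq H p q ∧ (∀ i ≤ q, p i ∈ X) ∧ ∀ i, 0 < i → i < q → degIn H X (p i) = 2

lemma eq_or_eq_of_degIn_eq_two {H : SimpleGraph V} {X : Finset V} {x a b : V}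
    (hx : degIn H X x = 2) (ha : a ∈ X) (hb : b ∈ X) (hxa : H.Adj x a) (hxb : H.Adj x b)
    (hab : a ≠ b) {y : V} (hy : y ∈ X) (hxy : H.Adj x y) : y = a ∨ y = b := by
  have hsub : ({a, b} : Finset V) ⊆ X.filter (fun y => H.Adj x y) := by
    intro z hz
    rw [Finset.mem_insert, Finset.mem_singleton] at hz
    rcases hz with rfl | rfl
    · exact Finset.mem_filter.2 ⟨ha, hxa⟩
    · exact Finset.mem_filter.2 ⟨hb, hxb⟩
  have heq := Finset.eq_of_subset_of_card_le hsub (by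
    rw [Finset.card_pair hab]
    exact hx.le)
  have : y ∈ ({a, b} : Finset V) := by
    rw [heq]
    exact Finset.mem_filter.2 ⟨hy, hxy⟩
  simpa using this

namespace IsSuspendedPath

variable {H : SimpleGraph V} {X : Finset V} {p : ℕ → V} {q : ℕ}

lemma inj (hp : IsSuspendedPath H X p q) {i j : ℕ} (hi : i ≤ q) (hj : j ≤ q) (h : p i = p j) :
    i = j := hp.1.1 hi hj h

lemma neighbor (hp : IsSuspendedPath H X p q) {i : ℕ} (hi : 0 < i) (hiq : i < q) {y : V}
    (hy : y ∈ X) (h : H.Adj (p i) y) : y = p (i - 1) ∨ y = p (i + 1) := by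
  refine eq_or_eq_of_degIn_eq_two (hp.2.2 i hi hiq) (hp.2.1 _ (by omega)) (hp.2.1 _ (by omega))
    ?_ (hp.1.2 i hiq) (fun h' => ?_) hy h
  · have := hp.1.2 (i - 1) (by omega)
    rw [Nat.sub_add_cancel hi] at this
    exact this.symm
  · have := hp.inj (by omega) (by omega) h'
    omega

lemma not_adj_zero_two (hp : IsSuspendedPath H X p q) (hq : 3 ≤ q) : ¬ H.Adj (p 0) (p 2) := by
  intro h
  rcases hp.neighbor (i := 2) (by omega) (by omega) (hp.2.1 0 (by omega)) h.symm with h' | h'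
  · have := hp.inj (by omega) (by omega) h'
    omega
  · have := hp.inj (by omega) (by omega) h'
    omega

/-- The graph obtained by joining the two neighbours of the first inner vertex. -/
def shortcut (H : SimpleGraph V) (p : ℕ → V) : SimpleGraph V := H ⊔ SimpleGraph.edge (p 0) (p 2)

lemma shortcut_adj {a b : V} : (shortcut H p).Adj a b ↔
    H.Adj a b ∨ ((a = p 0 ∧ b = p 2 ∨ a = p 2 ∧ b = p 0) ∧ a ≠ b) := by
  rw [shortcut, SimpleGraph.sup_adj, SimpleGraph.edge_adj]

/-- The vertices `p 0` and `p 2` trade the neighbour `p 1` for each other. They were not adjacent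
before, since `q ≥ 3` makes `p 2` an inner vertex. Hence shortening preserves the number of leaves
and the excess. -/
lemma degIn_shortcut (hp : IsSuspendedPath H X p q) (hq : 3 ≤ q) {x : V} (hx : x ∈ X.erase (p 1)) :
    degIn (shortcut H p) (X.erase (p 1)) x = degIn H X x := by
  have h02 : p 0 ≠ p 2 := fun h => by have := hp.inj (by omega) (by omega) h; omega
  have h01 : p 0 ≠ p 1 := fun h => by have := hp.inj (by omega) (by omega) h; omega
  have h21 : p 2 ≠ p 1 := fun h => by have := hp.inj (by omega) (by omega) h; omega
  have hn := hp.not_adj_zero_two hq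
  have ha01 : H.Adj (p 0) (p 1) := hp.1.2 0 (by omega)
  have ha12 : H.Adj (p 1) (p 2) := hp.1.2 1 (by omega)
  have hm : ∀ i ≤ q, p i ∈ X := hp.2.1
  rw [Finset.mem_erase] at hx
  have swap : ∀ a b : V, a ∈ X → b ∈ X → a ≠ b → a ≠ p 1 → b ≠ p 1 → H.Adj a (p 1) → ¬ H.Adj a b →
      (∀ y, (shortcut H p).Adj a y ↔ H.Adj a y ∨ y = b) →
      degIn (shortcut H p) (X.erase (p 1)) a = degIn H X a := by
    intro a b ha hb hab ha1 hb1 hadj hnadj hiff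
    have h1 : (X.erase (p 1)).filter (fun y => (shortcut H p).Adj a y) =
        insert b ((X.filter (fun y => H.Adj a y)).erase (p 1)) := by
      ext y
      simp only [Finset.mem_filter, Finset.mem_erase, Finset.mem_insert, hiff]
      constructor
      · tauto
      · rintro (rfl | h)
        · exact ⟨⟨hb1, hb⟩, Or.inr rfl⟩
        · tauto
    have h2 : p 1 ∈ X.filter (fun y => H.Adj a y) :=
      Finset.mem_filter.2 ⟨hm 1 (by omega), hadj⟩
    have h3 : b ∉ (X.filter (fun y => H.Adj a y)).erase (p 1) := by
      simp [hnadj]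
    simp only [degIn]
    rw [h1, Finset.card_insert_of_notMem h3, Finset.card_erase_add_one h2]
  by_cases hx0 : x = p 0
  · subst hx0
    refine swap _ (p 2) hx.2 (hm 2 (by omega)) h02 hx.1 h21 ha01 hn fun y => ?_
    rw [shortcut_adj]
    constructor
    · tauto
    · rintro (h | rfl)
      · exact Or.inl h
      · exact Or.inr ⟨Or.inl ⟨rfl, rfl⟩, h02⟩
  by_cases hx2 : x = p 2
  · subst hx2
    refine swap _ (p 0) hx.2 (hm 0 (by omega)) h02.symm hx.1 h01 ha12.symm (fun h => hn h.symm)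
      fun y => ?_
    rw [shortcut_adj]
    constructor
    · tauto
    · rintro (h | rfl)
      · exact Or.inl h
      · exact Or.inr ⟨Or.inr ⟨rfl, rfl⟩, h02.symm⟩
  have hx1 : ¬ H.Adj x (p 1) := by
    intro h
    rcases hp.neighbor (i := 1) (by omega) (by omega) hx.2 h.symm with h' | h'
    · exact hx0 h'
    · exact hx2 h'
  refine congrArg _ (Finset.ext fun y => ?_)
  simp only [Finset.mem_filter, Finset.mem_erase, shortcut_adj]
  constructor
  · tauto
  · rintro ⟨hy, hxy⟩
    exact ⟨⟨fun h => hx1 (h ▸ hxy), hy⟩, Or.inl hxy⟩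

lemma sum_degIn_shortcut (hp : IsSuspendedPath H X p q) (hq : 3 ≤ q) :
    ∑ x ∈ X.erase (p 1), degIn (shortcut H p) (X.erase (p 1)) x + 2 = ∑ x ∈ X, degIn H X x := by
  rw [Finset.sum_congr rfl fun x hx => hp.degIn_shortcut hq hx,
    ← Finset.sum_erase_add X _ (hp.2.1 1 (by omega)), hp.2.2 1 (by omega) (by omega)]

lemma cutConnected_shortcut (hp : IsSuspendedPath H X p q) (hq : 3 ≤ q) (hX : CutConnected H X) :
    CutConnected (shortcut H p) (X.erase (p 1)) := by
  have h02 : p 0 ≠ p 2 := fun h => by have := hp.inj (by omega) (by omega) h; omega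
  have h01 : p 0 ≠ p 1 := fun h => by have := hp.inj (by omega) (by omega) h; omega
  have h21 : p 2 ≠ p 1 := fun h => by have := hp.inj (by omega) (by omega) h; omega
  have hm : ∀ i ≤ q, p i ∈ X := hp.2.1
  intro A hA hne hneX
  have h1A : p 1 ∉ A := fun h => by simpa using hA h
  have hAX : A ⊆ X := hA.trans (X.erase_subset _)
  by_cases h0A : p 0 ∈ A
  · obtain ⟨a, ha, b, hb, hbA, hab⟩ := hX (insert (p 1) A)
      (Finset.insert_subset (hm 1 (by omega)) hAX) (by simp)
      (fun h => hneX (by rw [← h, Finset.erase_insert h1A]))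
    rw [Finset.mem_insert, not_or] at hbA
    rw [Finset.mem_insert] at ha
    rcases ha with rfl | ha
    · rcases hp.neighbor (i := 1) (by omega) (by omega) hb hab with h | h
      · exact absurd h0A (h ▸ hbA.2)
      · exact ⟨p 0, h0A, b, Finset.mem_erase.2 ⟨hbA.1, hb⟩, hbA.2,
          shortcut_adj.2 (Or.inr ⟨Or.inl ⟨rfl, h⟩, fun h' => hbA.2 (h' ▸ h0A)⟩)⟩
    · exact ⟨a, ha, b, Finset.mem_erase.2 ⟨hbA.1, hb⟩, hbA.2, shortcut_adj.2 (Or.inl hab)⟩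
  · obtain ⟨a, ha, b, hb, hbA, hab⟩ := hX A hAX hne (fun h => h1A (h ▸ hm 1 (by omega)))
    by_cases hb1 : b = p 1
    · subst hb1
      rcases hp.neighbor (i := 1) (by omega) (by omega) (hAX ha) hab.symm with h | h
      · exact absurd ha (h ▸ h0A)
      · exact ⟨a, ha, p 0, Finset.mem_erase.2 ⟨h01, hm 0 (by omega)⟩, h0A,
          shortcut_adj.2 (Or.inr ⟨Or.inr ⟨h, rfl⟩, fun h' => h0A (h' ▸ ha)⟩)⟩
    · exact ⟨a, ha, b, Finset.mem_erase.2 ⟨hb1, hb⟩, hbA, shortcut_adj.2 (Or.inl hab)⟩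

/-- The image of the shortened path has `q = 3k` vertices, and at least `n` host vertices are
unused. `IsPathSeq.lengthen` either gives a red clique for all of `X` or a red path with one more
vertex and the same ends. Its inner vertices may be permuted freely, since those of `p` have no
other neighbours. -/
lemma exists_partialEmb [Fintype W] {F : SimpleGraph W} {k n : ℕ} (hk : 3 ≤ k) (hodd : Odd k)
    (hB : NoCycleSeq Fᶜ k) (hp : IsSuspendedPath H X p q) (hq : q = 3 * k) (hkn : k ≤ n)
    (hXn : X.card ≤ n) (hW : 2 * n ≤ Fintype.card W + 1) {f : V → W}
    (hf : PartialEmb (shortcut H p) F (X.erase (p 1)) f) : ∃ g, PartialEmb H F X g := by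
  have h01 : p 0 ≠ p 1 := fun h => by have := hp.inj (by omega) (by omega) h; omega
  have hm : ∀ i ≤ q, p i ∈ X := hp.2.1
  have hmE : ∀ i ≤ q, i ≠ 1 → p i ∈ X.erase (p 1) := fun i hi h1 =>
    Finset.mem_erase.2 ⟨fun h => h1 (hp.inj hi (by omega) h), hm i hi⟩
  set U := Finset.univ \ (X.erase (p 1)).image f with hU
  have hUmem : ∀ y ∈ X.erase (p 1), f y ∉ U := fun y hy h =>
    (Finset.mem_sdiff.1 h).2 (Finset.mem_image_of_mem f hy)
  have hUcard : n ≤ U.card := by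
    have h1 := Finset.le_card_sdiff ((X.erase (p 1)).image f) Finset.univ
    have h2 := Finset.card_image_le (s := X.erase (p 1)) (f := f)
    have h3 := Finset.card_erase_add_one (hm 1 (by omega))
    rw [Finset.card_univ, ← hU] at h1
    omega
  -- Indexing of the shortened path, which skips `p 1`.
  set s : ℕ → ℕ := fun i => if i = 0 then 0 else i + 1 with hs
  have hsq : ∀ i ≤ q - 1, s i ≤ q ∧ s i ≠ 1 := by
    intro i hi
    simp only [hs]
    split_ifs <;> omega
  have hx : IsPathSeq F (fun i => f (p (s i))) (q - 1) := by
    constructor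
    · intro i hi j hj hij
      simp only [Set.mem_Iic] at hi hj
      have h1 := hf.1 (hmE _ (hsq i hi).1 (hsq i hi).2) (hmE _ (hsq j hj).1 (hsq j hj).2) hij
      have h2 := hp.inj (hsq i hi).1 (hsq j hj).1 h1
      simp only [hs] at h2
      split_ifs at h2 <;> omega
    · intro i hi
      have h1 := hsq i (by omega)
      have h2 := hsq (i + 1) (by omega)
      refine hf.2 _ (hmE _ h1.1 h1.2) _ (hmE _ h2.1 h2.2) (shortcut_adj.2 ?_)
      rcases i with _ | i
      · exact Or.inr ⟨Or.inl ⟨rfl, rfl⟩, fun h => by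
          have := hp.inj h1.1 h2.1 h
          simp [hs] at this⟩
      · exact Or.inl (hp.1.2 (i + 2) (by omega))
  rcases hx.lengthen hk hodd hB (by omega) U
    (fun i hi => hUmem _ (hmE _ (hsq i hi).1 (hsq i hi).2)) (hkn.trans hUcard) with hcl | hy
  · have : Nonempty W := ⟨f (p 0)⟩
    obtain ⟨g, hg, -⟩ := exists_partialEmb_of_clique H F hcl (hXn.trans hUcard)
    exact ⟨g, hg⟩
  obtain ⟨y, ⟨hyinj, hyadj⟩, hy0, hyq, hymem⟩ := hy
  rw [show q - 1 + 1 = q by omega] at hyinj hyadj hyq hymem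
  have hy0' : y 0 = f (p 0) := by simpa [hs] using hy0
  have hyq' : y q = f (p q) := by
    rw [hyq]
    simp only [hs]
    rw [if_neg (by omega), show q - 1 + 1 = q by omega]
  let g : V → W := fun v => if h : ∃ i ≤ q, p i = v then y h.choose else f v
  have hgp : ∀ i ≤ q, g (p i) = y i := by
    intro i hi
    have h : ∃ j ≤ q, p j = p i := ⟨i, hi, rfl⟩
    simp only [g, dif_pos h]
    rw [hp.inj h.choose_spec.1 hi h.choose_spec.2]
  have hgf : ∀ v, (¬ ∃ i ≤ q, p i = v) → g v = f v := by
    intro v h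
    simp only [g, dif_neg h]
  have hoff : ∀ v ∈ X, (¬ ∃ i ≤ q, p i = v) → v ∈ X.erase (p 1) := fun v hv h =>
    Finset.mem_erase.2 ⟨fun h' => h ⟨1, by omega, h'.symm⟩, hv⟩
  have hne : ∀ v ∈ X, (¬ ∃ i ≤ q, p i = v) → ∀ i ≤ q, y i ≠ f v := by
    intro v hv hvp i hi heq
    rcases hymem i hi with h | ⟨j, hj, h⟩
    · exact hUmem v (hoff v hv hvp) (heq ▸ h)
    · have h1 := hsq j hj
      exact hvp ⟨s j, h1.1, hf.1 (hmE _ h1.1 h1.2) (hoff v hv hvp) (h ▸ heq)⟩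
  have hedge : ∀ i ≤ q, ∀ b ∈ X, H.Adj (p i) b → F.Adj (g (p i)) (g b) := by
    intro i hi b hb hab
    by_cases hbp : ∃ j ≤ q, p j = b
    · obtain ⟨j, hj, rfl⟩ := hbp
      rw [hgp i hi, hgp j hj]
      -- An edge between non-consecutive path vertices can only join the two ends, where the old
      -- embedding still applies.
      have hcases : j + 1 = i ∨ j = i + 1 ∨ (i ≠ 1 ∧ j ≠ 1 ∧ y i = f (p i) ∧ y j = f (p j)) := by
        by_cases hi' : 0 < i ∧ i < q
        · rcases hp.neighbor hi'.1 hi'.2 hb hab with h | h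
          · have := hp.inj hj (by omega) h
            omega
          · have := hp.inj hj (by omega) h
            omega
        by_cases hj' : 0 < j ∧ j < q
        · rcases hp.neighbor hj'.1 hj'.2 (hm i hi) hab.symm with h | h
          · have := hp.inj hi (by omega) h
            omega
          · have := hp.inj hi (by omega) h
            omega
        have hend : ∀ t ≤ q, ¬ (0 < t ∧ t < q) → t ≠ 1 ∧ y t = f (p t) := by
          intro t ht htn
          rcases Nat.eq_zero_or_pos t with rfl | h
          · exact ⟨by omega, hy0'⟩
          · obtain rfl : t = q := by omega
            exact ⟨by omega, hyq'⟩
        have h1 := hend i hi hi'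
        have h2 := hend j hj hj'
        exact Or.inr (Or.inr ⟨h1.1, h2.1, h1.2, h2.2⟩)
      rcases hcases with rfl | rfl | ⟨h1, h2, h3, h4⟩
      · exact (hyadj j (by omega)).symm
      · exact hyadj i (by omega)
      · rw [h3, h4]
        exact hf.2 _ (hmE i hi h1) _ (hmE j hj h2) (shortcut_adj.2 (Or.inl hab))
    · have hi' : ¬ (0 < i ∧ i < q) := by
        intro h
        rcases hp.neighbor h.1 h.2 hb hab with h' | h'
        · exact hbp ⟨_, by omega, h'.symm⟩
        · exact hbp ⟨_, by omega, h'.symm⟩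
      rw [hgp i hi, hgf b hbp]
      have hyi : i ≠ 1 ∧ y i = f (p i) := by
        rcases Nat.eq_zero_or_pos i with rfl | h
        · exact ⟨by omega, hy0'⟩
        · obtain rfl : i = q := by omega
          exact ⟨by omega, hyq'⟩
      rw [hyi.2]
      exact hf.2 _ (hmE i hi hyi.1) _ (hoff b hb hbp) (shortcut_adj.2 (Or.inl hab))
  refine ⟨g, ?_, ?_⟩
  · intro a ha b hb hab
    rw [Finset.mem_coe] at ha hb
    by_cases hap : ∃ i ≤ q, p i = a <;> by_cases hbp : ∃ i ≤ q, p i = b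
    · obtain ⟨i, hi, rfl⟩ := hap
      obtain ⟨j, hj, rfl⟩ := hbp
      rw [hgp i hi, hgp j hj] at hab
      rw [hyinj hi hj hab]
    · obtain ⟨i, hi, rfl⟩ := hap
      rw [hgp i hi, hgf b hbp] at hab
      exact absurd hab (hne b hb hbp i hi)
    · obtain ⟨j, hj, rfl⟩ := hbp
      rw [hgp j hj, hgf a hap] at hab
      exact absurd hab.symm (hne a ha hap j hj)
    · rw [hgf a hap, hgf b hbp] at hab
      exact hf.1 (hoff a ha hap) (hoff b hb hbp) hab
  · intro a ha b hb hab
    by_cases hap : ∃ i ≤ q, p i = a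
    · obtain ⟨i, hi, rfl⟩ := hap
      exact hedge i hi b hb hab
    by_cases hbp : ∃ i ≤ q, p i = b
    · obtain ⟨j, hj, rfl⟩ := hbp
      exact (hedge j hj a ha hab.symm).symm
    rw [hgf a hap, hgf b hbp]
    exact hf.2 _ (hoff a ha hap) _ (hoff b hb hbp) (shortcut_adj.2 (Or.inl hab))

end IsSuspendedPath

/-! ### Counting vertices when no long suspended path exists -/

/-- A neighbour of `b` in `X` other than `a`, if there is one. -/
noncomputable def otherNeighbor (H : SimpleGraph V) (X : Finset V) (a b : V) : V :=
  if h : ∃ c ∈ X, H.Adj b c ∧ c ≠ a then h.choose else b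

/-- One step of the walk that does not turn back at vertices of degree two. -/
noncomputable def dartStep (H : SimpleGraph V) (X : Finset V) (d : V × V) : V × V :=
  (d.2, otherNeighbor H X d.1 d.2)

lemma otherNeighbor_spec {H : SimpleGraph V} {X : Finset V} {a b : V} (hb : degIn H X b = 2) :
    otherNeighbor H X a b ∈ X ∧ H.Adj b (otherNeighbor H X a b) ∧ otherNeighbor H X a b ≠ a := by
  have h : ∃ c ∈ X, H.Adj b c ∧ c ≠ a := by
    obtain ⟨c, hc, hca⟩ := Finset.exists_mem_ne (show 1 < degIn H X b by omega) a
    exact ⟨c, (Finset.mem_filter.1 hc).1, (Finset.mem_filter.1 hc).2, hca⟩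
  simp only [otherNeighbor, dif_pos h]
  exact ⟨h.choose_spec.1, h.choose_spec.2.1, h.choose_spec.2.2⟩

lemma otherNeighbor_eq {H : SimpleGraph V} {X : Finset V} {a b c : V} (hb : degIn H X b = 2)
    (ha : a ∈ X) (hba : H.Adj b a) (hc : c ∈ X) (hbc : H.Adj b c) (hca : c ≠ a) :
    otherNeighbor H X a b = c := by
  obtain ⟨h1, h2, h3⟩ := otherNeighbor_spec (a := a) hb
  rcases eq_or_eq_of_degIn_eq_two hb ha hc hba hbc hca.symm h1 h2 with h | h
  · exact absurd h h3
  · exact h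

/-- From a vertex of degree two, the walk in either direction reaches a vertex of another degree
in fewer than `q` steps. -/
lemma CutConnected.exists_iterate_dartStep {H : SimpleGraph V} {X : Finset V}
    (hX : CutConnected H X) {q : ℕ} (hbig : q < X.card)
    (hno : ∀ p, ¬ IsSuspendedPath H X p q) {x x' : V} (hx : x ∈ X) (hdx : degIn H X x = 2)
    (hx' : x' ∈ X) (hxx' : H.Adj x x') :
    ∃ y z, y ∈ X ∧ degIn H X y ≠ 2 ∧ z ∈ X ∧ H.Adj y z ∧
      ∃ i < q - 1, (dartStep H X)^[i] (y, z) = (x', x) := by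
  set v : ℕ → V := fun i => ((dartStep H X)^[i] (x, x')).1 with hv
  have hv0 : v 0 = x := rfl
  have hv1 : v 1 = x' := rfl
  have hstep : ∀ i, (dartStep H X)^[i] (x, x') = (v i, v (i + 1)) := by
    intro i
    simp only [hv, Function.iterate_succ_apply', dartStep]
  have hvs : ∀ i, v (i + 2) = otherNeighbor H X (v i) (v (i + 1)) := by
    intro i
    have := hstep (i + 1)
    rw [Function.iterate_succ_apply', hstep i] at this
    exact (congrArg Prod.snd this).symm
  have hbasic : ∀ i, (∀ j, 0 < j → j ≤ i → degIn H X (v j) = 2) →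
      v i ∈ X ∧ v (i + 1) ∈ X ∧ H.Adj (v i) (v (i + 1)) := by
    intro i
    induction i with
    | zero => exact fun _ => ⟨hx, hx', hxx'⟩
    | succ i ih =>
      intro h
      have h1 := ih fun j hj hji => h j hj (by omega)
      have h2 := otherNeighbor_spec (a := v i) (h (i + 1) (by omega) le_rfl)
      rw [← hvs] at h2
      exact ⟨h1.2.1, h2.1, h2.2.1⟩
  have hback : ∀ i, degIn H X (v (i + 1)) = 2 → v (i + 2) ≠ v i := by
    intro i hi
    rw [hvs]
    exact (otherNeighbor_spec hi).2.2
  -- Otherwise the walk either is a suspended path or returns to its start and exhausts `X`,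
  -- contrary to `q < X.card`.
  have hexists : ∃ i, 0 < i ∧ i < q ∧ degIn H X (v i) ≠ 2 := by
    by_contra hcon
    push Not at hcon
    have hdeg : ∀ i < q, degIn H X (v i) = 2 := by
      intro i hi
      rcases Nat.eq_zero_or_pos i with rfl | h
      · exact hdx
      · exact hcon i h hi
    have hb : ∀ i < q, v i ∈ X ∧ v (i + 1) ∈ X ∧ H.Adj (v i) (v (i + 1)) := fun i hi =>
      hbasic i fun j _ hji => hdeg j (by omega)
    have hinj : ∀ j ≤ q, ∀ i < j, v i ≠ v j := by
      intro j
      induction j using Nat.strong_induction_on with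
      | _ j ih =>
        intro hj i hij heq
        have hlast := hb (j - 1) (by omega)
        rw [Nat.sub_add_cancel (by omega : 1 ≤ j), ← heq] at hlast
        have hne2 : j ≠ i + 2 := by
          rintro rfl
          exact hback i (hdeg (i + 1) (by omega)) heq.symm
        have hne1 : j ≠ i + 1 := by
          rintro rfl
          exact (hb i (by omega)).2.2.ne heq
        rcases Nat.eq_zero_or_pos i with rfl | hi
        · -- the walk closes up, so it covers all of `X`
          have hA : (Finset.range j).image v = X := by
            by_contra hne
            obtain ⟨a, ha, b, hbX, hbA, hab⟩ := hX ((Finset.range j).image v)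
              (by
                intro a ha
                simp only [Finset.mem_image, Finset.mem_range] at ha
                obtain ⟨t, ht, rfl⟩ := ha
                exact (hb t (by omega)).1)
              ⟨v 0, Finset.mem_image_of_mem _ (Finset.mem_range.2 hij)⟩ hne
            simp only [Finset.mem_image, Finset.mem_range] at ha
            obtain ⟨t, ht, rfl⟩ := ha
            apply hbA
            simp only [Finset.mem_image, Finset.mem_range]
            rcases Nat.eq_zero_or_pos t with rfl | ht0
            · rcases eq_or_eq_of_degIn_eq_two hdx hx' hlast.1 hxx' hlast.2.2.symm
                (ih (j - 1) (by omega) (by omega) 1 (by omega)) hbX hab with h | h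
              · exact ⟨1, by omega, h.symm⟩
              · exact ⟨j - 1, by omega, h.symm⟩
            · have hp := hb (t - 1) (by omega)
              have hn := hb t (by omega)
              rw [Nat.sub_add_cancel ht0] at hp
              have hbk := hback (t - 1) (by
                rw [Nat.sub_add_cancel ht0]
                exact hdeg t (by omega))
              rw [show t - 1 + 2 = t + 1 by omega] at hbk
              rcases eq_or_eq_of_degIn_eq_two (hdeg t (by omega)) hp.1 hn.2.1 hp.2.2.symm hn.2.2
                hbk.symm hbX hab with h | h
              · exact ⟨t - 1, by omega, h.symm⟩
              · rcases Nat.lt_or_ge (t + 1) j with h1 | h1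
                · exact ⟨t + 1, h1, h.symm⟩
                · obtain rfl : j = t + 1 := by omega
                  exact ⟨0, by omega, heq.trans h.symm⟩
          have := Finset.card_image_le (s := Finset.range j) (f := v)
          rw [hA, Finset.card_range] at this
          omega
        -- The predecessor of the repeated vertex must be one of the two neighbours already visited
        -- around `v i`, which gives an earlier repetition.
        · have hp := hb (i - 1) (by omega)
          have hn := hb i (by omega)
          rw [Nat.sub_add_cancel hi] at hp
          have hbk := hback (i - 1) (by
            rw [Nat.sub_add_cancel hi]
            exact hdeg i (by omega))
          rw [show i - 1 + 2 = i + 1 by omega] at hbk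
          rcases eq_or_eq_of_degIn_eq_two (hdeg i (by omega)) hp.1 hn.2.1 hp.2.2.symm hn.2.2
            hbk.symm hlast.1 hlast.2.2.symm with h | h
          · exact ih (j - 1) (by omega) (by omega) (i - 1) (by omega) h.symm
          · exact ih (j - 1) (by omega) (by omega) (i + 1) (by omega) h.symm
    refine hno v ⟨⟨?_, fun i hi => (hb i hi).2.2⟩, ?_, fun i _ hi => hdeg i hi⟩
    · intro s hs t ht hst
      simp only [Set.mem_Iic] at hs ht
      rcases lt_trichotomy s t with h | h | h
      · exact absurd hst (hinj t ht s h)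
      · exact h
      · exact absurd hst.symm (hinj s hs t h)
    · intro i hi
      rcases Nat.eq_zero_or_pos i with rfl | h
      · exact hx
      · have := (hb (i - 1) (by omega)).2.1
        rwa [Nat.sub_add_cancel h] at this
  classical
  obtain ⟨hi0, hiq, hideg⟩ := Nat.find_spec hexists
  set i := Nat.find hexists with hi
  have hmin : ∀ j, 0 < j → j < i → degIn H X (v j) = 2 := by
    intro j hj hji
    by_contra hcon
    exact Nat.find_min hexists hji ⟨hj, by omega, hcon⟩
  have hb : ∀ j < i, v j ∈ X ∧ v (j + 1) ∈ X ∧ H.Adj (v j) (v (j + 1)) := fun j hj =>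
    hbasic j fun t ht htj => hmin t ht (by omega)
  have hlast := hb (i - 1) (by omega)
  rw [Nat.sub_add_cancel hi0] at hlast
  -- At vertices of degree two the walk is reversible, so it can be retraced from its end.
  have hrev : ∀ t, t < i → (dartStep H X)^[t] (v i, v (i - 1)) = (v (i - t), v (i - t - 1)) := by
    intro t
    induction t with
    | zero => exact fun _ => rfl
    | succ t ih =>
      intro ht
      rw [Function.iterate_succ_apply', ih (by omega), dartStep]
      obtain ⟨s, hs⟩ : ∃ s, i - t = s + 2 := ⟨i - t - 2, by omega⟩
      have h1 := hb s (by omega)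
      have h2 := hb (s + 1) (by omega)
      have hd := hmin (s + 1) (by omega) (by omega)
      rw [show i - (t + 1) = s + 1 by omega, hs]
      simp only [show s + 2 - 1 = s + 1 by omega, show s + 1 - 1 = s by omega]
      rw [otherNeighbor_eq hd h2.2.1 h2.2.2 h1.1 h1.2.2.symm (hback s hd).symm]
  refine ⟨v i, v (i - 1), hlast.2.1, hideg, hlast.1, hlast.2.2.symm, i - 1, by omega, ?_⟩
  rw [hrev (i - 1) (by omega), show i - (i - 1) = 1 by omega]
  exact Prod.ext hv1 hv0

lemma card_sigma_darts {H : SimpleGraph V} {X : Finset V} (Y : Finset V) :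
    (Y.sigma fun y => X.filter (fun z => H.Adj y z)).card = ∑ y ∈ Y, degIn H X y :=
  Finset.card_sigma _ _

/-- Directed edges leaving degree-two vertices are charged to directed edges leaving the other
vertices, each charged at most `q - 1` times. The degree sum bounds the latter by four times the
number of leaves plus `6 * l`. -/
lemma CutConnected.card_le_of_no_suspendedPath {H : SimpleGraph V} {X : Finset V}
    (hX : CutConnected H X) {q l : ℕ} (hq : 1 ≤ q) (hcard : 2 ≤ X.card) (hbig : q < X.card)
    (hsum : ∑ x ∈ X, degIn H X x ≤ 2 * (X.card + l))
    (hno : ∀ p, ¬ IsSuspendedPath H X p q) :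
    X.card ≤ q * (2 * (X.filter (fun x => degIn H X x = 1)).card + 3 * l) := by
  set X1 := X.filter (fun x => degIn H X x = 1) with hX1
  set X2 := X.filter (fun x => degIn H X x = 2) with hX2
  set Y := X.filter (fun x => degIn H X x ≠ 2) with hY
  set X3 := Y.filter (fun x => ¬ degIn H X x = 1) with hX3
  have hc1 : X2.card + Y.card = X.card := Finset.card_filter_add_card_filter_not _
  have hs1 : ∑ x ∈ X2, degIn H X x + ∑ x ∈ Y, degIn H X x = ∑ x ∈ X, degIn H X x :=
    Finset.sum_filter_add_sum_filter_not _ _ _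
  have hY1 : Y.filter (fun x => degIn H X x = 1) = X1 := by
    ext x
    simp only [hY, hX1, Finset.mem_filter]
    constructor
    · tauto
    · rintro ⟨h1, h2⟩
      exact ⟨⟨h1, by omega⟩, h2⟩
  have hc2 : X1.card + X3.card = Y.card := by
    rw [← hY1]
    exact Finset.card_filter_add_card_filter_not _
  have hs2 : ∑ x ∈ X1, degIn H X x + ∑ x ∈ X3, degIn H X x = ∑ x ∈ Y, degIn H X x := by
    rw [← hY1]
    exact Finset.sum_filter_add_sum_filter_not _ _ _
  have hs3 : ∑ x ∈ X2, degIn H X x = X2.card * 2 :=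
    Finset.sum_const_nat fun x hx => (Finset.mem_filter.1 hx).2
  have hs4 : ∑ x ∈ X1, degIn H X x = X1.card * 1 :=
    Finset.sum_const_nat fun x hx => (Finset.mem_filter.1 hx).2
  have hs5 : X3.card * 3 ≤ ∑ x ∈ X3, degIn H X x := by
    rw [← smul_eq_mul]
    refine Finset.card_nsmul_le_sum _ _ _ fun x hx => ?_
    simp only [hX3, hY, Finset.mem_filter] at hx
    have := hX.degIn_pos hcard hx.1.1
    omega
  have hdarts : ∑ x ∈ X2, degIn H X x ≤ (∑ x ∈ Y, degIn H X x) * (q - 1) := by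
    rw [← card_sigma_darts, ← card_sigma_darts, ← Finset.card_range (q - 1),
      ← Finset.card_product]
    -- The walk arrives at the degree-two vertex, so its last dart is reversed to obtain one leaving
    -- it.
    refine Finset.card_le_card_of_surjOn (fun s =>
      let d := (dartStep H X)^[s.2] (s.1.1, s.1.2)
      ⟨d.2, d.1⟩) ?_
    rintro ⟨x, x'⟩ hx
    simp only [Finset.coe_sigma, Set.mem_sigma_iff, Finset.mem_coe, hX2, Finset.mem_filter] at hx
    obtain ⟨y, z, hyX, hyd, hz, hyz, i, hi, heq⟩ :=
      hX.exists_iterate_dartStep hbig hno hx.1.1 hx.1.2 hx.2.1 hx.2.2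
    refine ⟨(⟨y, z⟩, i), ?_, ?_⟩
    · simp only [Finset.coe_product, Set.mem_prod, Finset.mem_coe, Finset.mem_sigma, hY,
        Finset.mem_filter, Finset.mem_range]
      exact ⟨⟨⟨hyX, hyd⟩, hz, hyz⟩, hi⟩
    · simp only [heq]
  have h3 : ∑ x ∈ X3, degIn H X x ≤ 3 * X1.card + 6 * l := by omega
  have h4 : X2.card * 2 ≤ (4 * X1.card + 6 * l) * (q - 1) := by
    rw [← hs3]
    exact hdarts.trans (Nat.mul_le_mul_right _ (by omega))
  have h5 : Y.card ≤ 2 * X1.card + 2 * l := by omega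
  obtain ⟨r, rfl⟩ : ∃ r, q = r + 1 := ⟨q - 1, by omega⟩
  simp only [Nat.add_sub_cancel] at h4
  nlinarith

/-! ### Degree bookkeeping and parents of leaves -/

lemma exists_adj_of_degIn_pos {H : SimpleGraph V} {X : Finset V} {x : V} (h : 0 < degIn H X x) :
    ∃ y ∈ X, H.Adj x y := by
  obtain ⟨y, hy⟩ := Finset.card_pos.1 h
  exact ⟨y, (Finset.mem_filter.1 hy).1, (Finset.mem_filter.1 hy).2⟩

lemma degIn_pos_of_adj {H : SimpleGraph V} {X : Finset V} {x y : V} (hy : y ∈ X)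
    (h : H.Adj x y) : 0 < degIn H X x :=
  Finset.card_pos.2 ⟨y, Finset.mem_filter.2 ⟨hy, h⟩⟩

lemma exists_card_eq_degIn (H : SimpleGraph V) (X : Finset V) (x : V) :
    ∃ N : Finset V, N.card = degIn H X x ∧ ∀ y ∈ N, H.Adj x y :=
  ⟨_, rfl, fun _ hy => (Finset.mem_filter.1 hy).2⟩

lemma degIn_le_add_sdiff (H : SimpleGraph V) (X S : Finset V) (x : V) :
    degIn H X x ≤ degIn H S x + degIn H (X \ S) x := by
  refine le_trans (Finset.card_le_card fun y hy => ?_) (Finset.card_union_le _ _)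
  obtain ⟨hy1, hy2⟩ := Finset.mem_filter.1 hy
  by_cases hyS : y ∈ S
  · exact Finset.mem_union_left _ (Finset.mem_filter.2 ⟨hyS, hy2⟩)
  · exact Finset.mem_union_right _ (Finset.mem_filter.2 ⟨Finset.mem_sdiff.2 ⟨hy1, hyS⟩, hy2⟩)

/-- Two adjacent leaves would form a whole component. -/
lemma CutConnected.degIn_ne_one_of_leaf {H : SimpleGraph V} {X : Finset V} (hX : CutConnected H X)
    (hcard : 3 ≤ X.card) {x p : V} (hx : x ∈ X) (hp : p ∈ X) (hdx : degIn H X x = 1)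
    (hxp : H.Adj x p) : degIn H X p ≠ 1 := by
  intro hdp
  obtain ⟨x', -, -, hx'⟩ := exists_unique_neighbor hdp
  obtain ⟨p', -, -, hp'⟩ := exists_unique_neighbor hdx
  obtain ⟨a, ha, b, hb, hbA, hab⟩ := hX {x, p}
    (by
      intro y hy
      rw [Finset.mem_insert, Finset.mem_singleton] at hy
      rcases hy with rfl | rfl <;> assumption) (by simp)
    (fun h => by
      have := Finset.card_le_two (a := x) (b := p)
      rw [h] at this
      omega)
  simp only [Finset.mem_insert, Finset.mem_singleton, not_or] at ha hbA
  rcases ha with rfl | rfl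
  · exact hbA.2 ((hp' b hb hab).trans (hp' p hp hxp).symm)
  · exact hbA.1 ((hx' b hb hab).trans (hx' x hx hxp.symm).symm)

/-- A choice of parents for the leaves of `H` in `X`. -/
lemma CutConnected.exists_parent {H : SimpleGraph V} {X : Finset V} (hX : CutConnected H X)
    (hcard : 3 ≤ X.card) : ∃ par : V → V, ∀ x ∈ X, degIn H X x = 1 →
      par x ∈ X ∧ degIn H X (par x) ≠ 1 ∧ ∀ y ∈ X, H.Adj x y → y = par x := by
  have : ∀ x, ∃ p, x ∈ X → degIn H X x = 1 →
      p ∈ X ∧ degIn H X p ≠ 1 ∧ ∀ y ∈ X, H.Adj x y → y = p := by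
    intro x
    by_cases h : x ∈ X ∧ degIn H X x = 1
    · obtain ⟨p, hp, hxp, hu⟩ := exists_unique_neighbor h.2
      exact ⟨p, fun _ _ => ⟨hp, hX.degIn_ne_one_of_leaf hcard h.1 hp h.2 hxp, hu⟩⟩
    · exact ⟨x, fun h1 h2 => absurd ⟨h1, h2⟩ h⟩
  choose par hpar using this
  exact ⟨par, hpar⟩

/-! ### Embeddings into particular hosts -/

/-- Embedding when every vertex of the host has degree at least `n - 1`. -/
lemma exists_partialEmb_of_minDegree [Fintype W] {F : SimpleGraph W} {k n l : ℕ} (hk : 3 ≤ k)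
    (hodd : Odd k) (hB : NoCycleSeq Fᶜ k) (hkn : k ≤ n) (hW : 2 * n ≤ Fintype.card W + 1)
    (hred : ∀ w, n ≤ degIn F Finset.univ w + 1) {K : Finset W}
    (hK : ∀ a ∈ K, ∀ b ∈ K, a ≠ b → F.Adj a b) (hK1 : 3 * k * (3 * l) ≤ K.card)
    (hK2 : 3 * k ≤ K.card) (H : SimpleGraph V) (X : Finset V) (hX : CutConnected H X)
    (hsum : ∑ x ∈ X, degIn H X x ≤ 2 * (X.card + l)) (hXn : X.card ≤ n) :
    ∃ f, PartialEmb H F X f := by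
  have : Nonempty W := Fintype.card_pos_iff.1 (by omega)
  induction hm : X.card generalizing H X with
  | zero =>
    obtain ⟨f, hf, -⟩ := exists_partialEmb_of_clique H F hK (X := X) (by omega)
    exact ⟨f, hf⟩
  | succ m ih =>
    rcases Nat.lt_or_ge K.card X.card with hbig | hsmall
    swap
    · obtain ⟨f, hf, -⟩ := exists_partialEmb_of_clique H F hK hsmall
      exact ⟨f, hf⟩
    by_cases hleaf : ∃ x ∈ X, degIn H X x = 1
    · obtain ⟨x, hx, hdx⟩ := hleaf
      have hcard := Finset.card_erase_add_one hx
      rw [sum_degIn_erase H X hx, hdx] at hsum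
      obtain ⟨f, hf⟩ := ih H (X.erase x) (hX.erase_leaf hx hdx) (by omega) (by omega) (by omega)
      obtain ⟨p, hp, hxp, hu⟩ := exists_unique_neighbor hdx
      obtain ⟨g, hg, -⟩ := hf.add_leaves (fun _ => p) {x} (by simp)
        (by
          intro y hy
          rw [Finset.mem_singleton] at hy
          subst hy
          refine ⟨Finset.mem_erase.2 ⟨hxp.ne.symm, hp⟩, fun z hz hyz => hu z ?_ hyz⟩
          rw [Finset.mem_union, Finset.mem_erase, Finset.mem_singleton] at hz
          rcases hz with hz | rfl
          · exact hz.2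
          · exact hx)
        (by
          intro y _
          have := hred (f p)
          simp only [Finset.card_singleton]
          omega)
      refine ⟨g, ?_⟩
      rwa [Finset.union_comm, ← Finset.insert_eq, Finset.insert_erase hx] at hg
    by_cases hsus : ∃ p, IsSuspendedPath H X p (3 * k)
    · obtain ⟨p, hp⟩ := hsus
      have hcard := Finset.card_erase_add_one (hp.2.1 1 (by omega))
      have hs := hp.sum_degIn_shortcut (by omega)
      obtain ⟨f, hf⟩ := ih _ _ (hp.cutConnected_shortcut (by omega) hX) (by omega) (by omega)
        (by omega)
      exact hp.exists_partialEmb hk hodd hB rfl hkn hXn hW hf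
    push Not at hleaf hsus
    have h := hX.card_le_of_no_suspendedPath (by omega) (by omega) (by omega) hsum hsus
    rw [Finset.filter_false_of_mem hleaf, Finset.card_empty, Nat.mul_zero, Nat.zero_add] at h
    omega

/-- Embedding graphs with few leaves into nearly complete hosts. -/
lemma exists_partialEmb_of_few_leaves [Fintype W] {F : SimpleGraph W} {k n l : ℕ} (hk : 3 ≤ k)
    (hodd : Odd k) (hB : NoCycleSeq Fᶜ k) (hkn : k ≤ n) (hW : 2 * n ≤ Fintype.card W + 1)
    {S : Finset W} {D M q : ℕ} (hS : ∀ u ∈ S, degIn Fᶜ S u ≤ D) {K : Finset W} (hKS : K ⊆ S)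
    (hK : ∀ a ∈ K, ∀ b ∈ K, a ≠ b → F.Adj a b) (hKl : 2 * l ≤ K.card)
    (hM : M + 2 * D ≤ S.card) (hM1 : 3 * k ≤ M) (hM2 : 3 * k * (2 * q + 3 * l) ≤ M)
    (H : SimpleGraph V) (X : Finset V) (hX : CutConnected H X)
    (hsum : ∑ x ∈ X, degIn H X x ≤ 2 * (X.card + l)) (hXn : X.card ≤ n)
    (hleaf : (X.filter (fun x => degIn H X x = 1)).card ≤ q) :
    ∃ f, PartialEmb H F X f := by
  have : Nonempty W := Fintype.card_pos_iff.1 (by omega)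
  induction hm : X.card generalizing H X with
  | zero =>
    obtain ⟨f, hf, -⟩ := exists_partialEmb_of_clique H F hK (X := X) (by omega)
    exact ⟨f, hf⟩
  | succ m ih =>
    rcases Nat.lt_or_ge M X.card with hbig | hsmall
    · obtain ⟨p, hp⟩ : ∃ p, IsSuspendedPath H X p (3 * k) := by
        by_contra hsus
        push Not at hsus
        have h := hX.card_le_of_no_suspendedPath (by omega) (by omega) (by omega) hsum hsus
        have h2 := Nat.mul_le_mul_left (3 * k)
          (Nat.add_le_add_right (Nat.mul_le_mul_left 2 hleaf) (3 * l))
        omega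
      have hcard := Finset.card_erase_add_one (hp.2.1 1 (by omega))
      have hs := hp.sum_degIn_shortcut (by omega)
      obtain ⟨f, hf⟩ := ih _ _ (hp.cutConnected_shortcut (by omega) hX) (by omega) (by omega)
        (by
          refine (Finset.card_le_card fun x hx => ?_).trans hleaf
          rw [Finset.mem_filter] at hx ⊢
          rw [hp.degIn_shortcut (by omega) hx.1] at hx
          exact ⟨Finset.mem_of_mem_erase hx.1, hx.2⟩) (by omega)
      exact hp.exists_partialEmb hk hodd hB rfl hkn hXn hW hf
    -- With `d = 2` the core has at most `2 * l` vertices, and at most `2 * D` vertices of `S` are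
    -- blocked at each step.
    · obtain ⟨f, hf, -⟩ := exists_partialEmb_of_lists H F 2 D (fun _ => S) hK X (fun _ _ => hKS)
        (fun X' hX' hmin => by
          have := hX.card_core_le hsum X' hX' hmin
          omega)
        (fun _ _ _ _ u hu => hS u hu)
        (fun X' hX' x hx hxX' f _ _ => by
          have h1 := Finset.card_le_card (Finset.inter_subset_left (s₁ := X'.image f) (s₂ := S))
          have h2 := Finset.card_image_le (s := X') (f := f)
          have h3 := Finset.card_lt_card (Finset.ssubset_iff_subset_ne.2
            ⟨hX', fun h => hxX' (h ▸ hx)⟩)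
          omega)
      exact ⟨f, hf⟩

lemma card_le_degIn_add_degIn_compl (F : SimpleGraph W) {S : Finset W} {u : W} (hu : u ∈ S) :
    S.card = degIn F S u + degIn Fᶜ S u + 1 := by
  have h1 := Finset.card_erase_add_one hu
  have h2 := Finset.card_filter_add_card_filter_not (s := S.erase u) (fun y => F.Adj u y)
  have h3 : ((S.erase u).filter (fun y => F.Adj u y)).card = degIn F S u := by
    refine congrArg _ (Finset.ext fun y => ?_)
    simp only [Finset.mem_filter, Finset.mem_erase]
    exact ⟨fun h => ⟨h.1.2, h.2⟩, fun h => ⟨⟨h.2.ne.symm, h.1⟩, h.2⟩⟩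
  have h4 : ((S.erase u).filter (fun y => ¬ F.Adj u y)).card = degIn Fᶜ S u := by
    refine congrArg _ (Finset.ext fun y => ?_)
    simp only [Finset.mem_filter, Finset.mem_erase, SimpleGraph.compl_adj]
    exact ⟨fun h => ⟨h.1.2, fun h' => h.1.1 h'.symm, h.2⟩,
      fun h => ⟨⟨fun h' => h.2.1 h'.symm, h.1⟩, h.2.2⟩⟩
  omega

lemma degIn_mono {H : SimpleGraph V} {X X' : Finset V} (h : X ⊆ X') (x : V) :
    degIn H X x ≤ degIn H X' x :=
  Finset.card_le_card (Finset.filter_subset_filter _ h)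

/-- Embedding graphs with many leaves into a nearly complete host `S` on `n` vertices, when enough
vertices of `S` have degree at least `n - 1` in the whole graph. -/
lemma exists_partialEmb_of_many_leaves [Fintype W] {F : SimpleGraph W} {n l D : ℕ}
    {S S0 Q K : Finset W} (hS0S : S0 ⊆ S) (hSn : S.card = n) (hS0 : ∀ u ∈ S0, degIn Fᶜ S u ≤ D)
    (hQS : Q ⊆ S0) (hQ : ∀ u ∈ Q, n ≤ degIn F Finset.univ u + 1) (hKQ : K ⊆ Q)
    (hK : ∀ a ∈ K, ∀ b ∈ K, a ≠ b → F.Adj a b) (hKl : K.card = 2 * l)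
    (hQcard : Q.card = 3 * D + 2 * l + 1) {H : SimpleGraph V} {X : Finset V}
    (hX : CutConnected H X) (hsum : ∑ x ∈ X, degIn H X x ≤ 2 * (X.card + l)) (hXn : X.card = n)
    (hn : 3 ≤ n)
    (hleaf : n + Q.card + 2 * D ≤ (X.filter (fun x => degIn H X x = 1)).card + S0.card) :
    ∃ f, PartialEmb H F X f := by
  have : Nonempty W := by
    obtain ⟨w, -⟩ := Finset.card_pos.1 (show 0 < S.card by omega)
    exact ⟨w⟩
  obtain ⟨par, hpar⟩ := hX.exists_parent (by omega)
  set L := X.filter (fun x => degIn H X x = 1) with hL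
  have hLX : L ⊆ X := Finset.filter_subset _ _
  have hS0n : S0.card ≤ n := hSn ▸ Finset.card_le_card hS0S
  -- Parents in `S0` have enough red neighbours for all but the last `D` leaves. These form `L'`,
  -- and their parents are sent to `Q`.
  obtain ⟨L', hL'L, hL'card⟩ := Finset.exists_subset_card_eq (show D ≤ L.card by omega)
  have hparL : ∀ x ∈ L, par x ∈ X \ L ∧ ∀ y ∈ X, H.Adj x y → y = par x := by
    intro x hx
    rw [hL, Finset.mem_filter] at hx
    obtain ⟨h1, h2, h3⟩ := hpar x hx.1 hx.2
    refine ⟨Finset.mem_sdiff.2 ⟨h1, fun h => h2 (Finset.mem_filter.1 h).2⟩, h3⟩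
  set Y := L'.image par with hY
  have hYcard : Y.card ≤ D := Finset.card_image_le.trans hL'card.le
  set A : V → Finset W := fun x => if x ∈ Y then Q else (S0 \ Q) ∪ K with hA
  have hAS : ∀ x, A x ⊆ S0 := by
    intro x
    simp only [hA]
    split_ifs
    · exact hQS
    · exact Finset.union_subset Finset.sdiff_subset (hKQ.trans hQS)
  have hX0 : (X \ L).card + L.card = X.card := Finset.card_sdiff_add_card_eq_card hLX
  obtain ⟨f, hf, hfA⟩ := exists_partialEmb_of_lists H F 2 D A hK (X \ L)
    (by
      intro x _
      simp only [hA]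
      split_ifs
      · exact hKQ
      · exact Finset.subset_union_right)
    (fun X' hX' hmin => by
      have := hX.card_core_le hsum X' (hX'.trans Finset.sdiff_subset) hmin
      omega)
    (fun x _ y _ u hu =>
      (degIn_mono ((hAS y).trans hS0S) u).trans (hS0 u (hAS x hu)))
    (by
      intro X' hX' x hx hxX' f hf hfA
      have h3 := Finset.card_lt_card (Finset.ssubset_iff_subset_ne.2
        ⟨hX', fun h => hxX' (h ▸ hx)⟩)
      by_cases hxY : x ∈ Y
      · have hAx : A x = Q := if_pos hxY
        rw [hAx]
        have hsub : X'.image f ∩ Q ⊆ Y.image f ∪ K := by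
          intro w hw
          rw [Finset.mem_inter, Finset.mem_image] at hw
          obtain ⟨⟨y, hy, rfl⟩, hwQ⟩ := hw
          by_cases hyY : y ∈ Y
          · exact Finset.mem_union_left _ (Finset.mem_image_of_mem f hyY)
          · have := hfA y hy
            simp only [hA, if_neg hyY, Finset.mem_union, Finset.mem_sdiff] at this
            exact Finset.mem_union_right _ (by tauto)
        have h1 := (Finset.card_le_card hsub).trans (Finset.card_union_le _ _)
        have h2 := Finset.card_image_le (s := Y) (f := f)
        omega
      · have hAx : A x = (S0 \ Q) ∪ K := if_neg hxY
        rw [hAx]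
        have h1 := Finset.card_le_card
          (Finset.inter_subset_left (s₁ := X'.image f) (s₂ := (S0 \ Q) ∪ K))
        have h2 := Finset.card_image_le (s := X') (f := f)
        have h4 := Finset.card_le_card (Finset.subset_union_left (s₁ := S0 \ Q) (s₂ := K))
        have h5 := Finset.card_sdiff_add_card_eq_card hQS
        omega)
  have hfS : ∀ x ∈ X \ L, f x ∈ S0 := fun x hx => hAS x (hfA x hx)
  have hX1 : (X \ L) ∪ (L \ L') = X \ L' := by
    ext y
    have h1 := @hL'L y
    have h2 := @hLX y
    simp only [Finset.mem_union, Finset.mem_sdiff]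
    tauto
  have hX2 : (X \ L') ∪ L' = X := Finset.sdiff_union_of_subset (hL'L.trans hLX)
  have hc1 : (X \ L').card + L'.card = X.card :=
    Finset.card_sdiff_add_card_eq_card (hL'L.trans hLX)
  have hc2 : (L \ L').card + L'.card = L.card := Finset.card_sdiff_add_card_eq_card hL'L
  obtain ⟨g, hg, hgf⟩ := hf.add_leaves par (L \ L')
    (Finset.sdiff_disjoint.mono_right Finset.sdiff_subset)
    (by
      intro x hx
      obtain ⟨h1, h2⟩ := hparL x (Finset.mem_sdiff.1 hx).1
      refine ⟨h1, fun y hy => h2 y ?_⟩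
      rw [hX1] at hy
      exact (Finset.mem_sdiff.1 hy).1)
    (by
      intro x hx
      have h1 := hfS _ (hparL x (Finset.mem_sdiff.1 hx).1).1
      have h2 := card_le_degIn_add_degIn_compl F (hS0S h1)
      have h3 := hS0 _ h1
      have h4 := degIn_mono (H := F) (Finset.subset_univ S) (f (par x))
      omega)
  rw [hX1] at hg
  obtain ⟨g', hg', -⟩ := hg.add_leaves par L' Finset.sdiff_disjoint
    (by
      intro x hx
      obtain ⟨h1, h2⟩ := hparL x (hL'L hx)
      refine ⟨Finset.sdiff_subset_sdiff subset_rfl hL'L h1, fun y hy => h2 y ?_⟩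
      rwa [hX2] at hy)
    (by
      intro x hx
      have h0 := (hparL x (hL'L hx)).1
      rw [hgf _ h0]
      have h1 := hfA _ h0
      have h2 : A (par x) = Q := if_pos (Finset.mem_image_of_mem par hx)
      rw [h2] at h1
      have := hQ _ h1
      omega)
  rw [hX2] at hg'
  exact ⟨g', hg'⟩

/-- Embedding graphs with enough leaves into a clique `P` enlarged by vertices `R` that miss at
most one vertex of `P` each. -/
lemma exists_partialEmb_of_clique_add {F : SimpleGraph W} {n : ℕ} {P R : Finset W}
    (hP : ∀ a ∈ P, ∀ b ∈ P, a ≠ b → F.Adj a b) (hPR : Disjoint P R)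
    (hR : ∀ r ∈ R, degIn Fᶜ P r ≤ 1) (hcard : P.card + R.card = n) (hRn : 3 * R.card ≤ n)
    {H : SimpleGraph V} {X : Finset V} (hX : CutConnected H X) (hXn : X.card = n) (hn : 3 ≤ n)
    (hleaf : R.card ≤ (X.filter (fun x => degIn H X x = 1)).card) :
    ∃ f, PartialEmb H F X f := by
  have : Nonempty W := by
    obtain ⟨w, -⟩ := Finset.card_pos.1 (show 0 < P.card by omega)
    exact ⟨w⟩
  obtain ⟨par, hpar⟩ := hX.exists_parent (by omega)
  obtain ⟨L, hL, hLcard⟩ := Finset.exists_subset_card_eq hleaf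
  have hLX : L ⊆ X := hL.trans (Finset.filter_subset _ _)
  have hparL : ∀ x ∈ L, par x ∈ X \ L ∧ ∀ y ∈ X, H.Adj x y → y = par x := by
    intro x hx
    have hx' := Finset.mem_filter.1 (hL hx)
    obtain ⟨h1, h2, h3⟩ := hpar x hx'.1 hx'.2
    exact ⟨Finset.mem_sdiff.2 ⟨h1, fun h => h2 (Finset.mem_filter.1 (hL h)).2⟩, h3⟩
  set Y := L.image par with hY
  have hYX : Y ⊆ X \ L := by
    intro y hy
    obtain ⟨x, hx, rfl⟩ := Finset.mem_image.1 hy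
    exact (hparL x hx).1
  have hYcard : Y.card ≤ R.card := Finset.card_image_le.trans hLcard.le
  -- Leaves will occupy `R`; their parents avoid every vertex of `P` with a blue neighbour in `R`,
  -- so any assignment of leaves to `R` works.
  set bad := R.biUnion (fun r => P.filter (fun w => Fᶜ.Adj r w)) with hbad
  have hbadcard : bad.card ≤ R.card := by
    refine (Finset.card_biUnion_le_card_mul _ _ 1 fun r hr => ?_).trans (by omega)
    refine le_of_eq_of_le ?_ (hR r hr)
    simp only [degIn]
    congr
  have hgood := Finset.le_card_sdiff bad P
  obtain ⟨AY, hAY, hAYcard⟩ := Finset.exists_subset_card_eq (show Y.card ≤ (P \ bad).card by omega)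
  have hAYP : AY ⊆ P := hAY.trans Finset.sdiff_subset
  set A : V → Finset W := fun x => if x ∈ Y then AY else P \ AY with hA
  have hAP : ∀ x, A x ⊆ P := by
    intro x
    simp only [hA]
    split_ifs
    · exact hAYP
    · exact Finset.sdiff_subset
  have hX0 : (X \ L).card + L.card = X.card := Finset.card_sdiff_add_card_eq_card hLX
  -- No degree exceeds `X.card`, so the core is empty, and `Δ = 0` as all lists lie in the clique
  -- `P`. Only the sizes of the lists matter.
  obtain ⟨f, hf, hfA⟩ := exists_partialEmb_of_lists H F X.card 0 A (K := ∅) (by simp) (X \ L)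
    (by simp)
    (fun X' hX' hmin => by
      rcases X'.eq_empty_or_nonempty with rfl | ⟨x, hx⟩
      · simp
      · have h1 := hmin x hx
        have h2 : degIn H X' x ≤ X'.card := Finset.card_filter_le _ _
        have h3 := Finset.card_le_card hX'
        omega)
    (fun x _ y _ u hu => by
      by_contra hcon
      obtain ⟨w, hw, huw⟩ := exists_adj_of_degIn_pos (Nat.lt_of_not_le hcon)
      rw [SimpleGraph.compl_adj] at huw
      exact huw.2 (hP u (hAP x hu) w (hAP y hw) huw.1))
    (by
      intro X' hX' x hx hxX' f hf hfA
      by_cases hxY : x ∈ Y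
      · have hAx : A x = AY := if_pos hxY
        rw [hAx]
        have hsub : X'.image f ∩ AY ⊆ (Y.erase x).image f := by
          intro w hw
          rw [Finset.mem_inter, Finset.mem_image] at hw
          obtain ⟨⟨y, hy, rfl⟩, hwA⟩ := hw
          refine Finset.mem_image_of_mem f (Finset.mem_erase.2 ⟨fun h => hxX' (h ▸ hy), ?_⟩)
          by_contra hyY
          have := hfA y hy
          simp only [hA, if_neg hyY, Finset.mem_sdiff] at this
          exact this.2 hwA
        have h1 := (Finset.card_le_card hsub).trans Finset.card_image_le
        have h2 := Finset.card_erase_add_one hxY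
        omega
      · have hAx : A x = P \ AY := if_neg hxY
        rw [hAx]
        have hsub : X'.image f ∩ (P \ AY) ⊆ (((X \ L) \ Y).erase x).image f := by
          intro w hw
          rw [Finset.mem_inter, Finset.mem_image] at hw
          obtain ⟨⟨y, hy, rfl⟩, hwA⟩ := hw
          refine Finset.mem_image_of_mem f (Finset.mem_erase.2 ⟨fun h => hxX' (h ▸ hy),
            Finset.mem_sdiff.2 ⟨hX' hy, fun hyY => ?_⟩⟩)
          have := hfA y hy
          simp only [hA, if_pos hyY] at this
          exact (Finset.mem_sdiff.1 hwA).2 this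
        have h1 := (Finset.card_le_card hsub).trans Finset.card_image_le
        have h2 := Finset.card_erase_add_one (Finset.mem_sdiff.2 ⟨hx, hxY⟩)
        have h3 := Finset.card_sdiff_add_card_eq_card hYX
        have h4 := Finset.card_sdiff_add_card_eq_card hAYP
        omega)
  -- With these trivial graphs, `e` is just an injection of `L` into `R`.
  obtain ⟨e, he, heR⟩ := exists_partialEmb_of_clique (⊥ : SimpleGraph V) (⊤ : SimpleGraph W)
    (X := L) (K := R) (by simp) hLcard.le
  have hfP : ∀ x ∈ X, x ∉ L → f x ∈ P := fun x hx hxL =>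
    hAP x (hfA x (Finset.mem_sdiff.2 ⟨hx, hxL⟩))
  have hedge : ∀ x ∈ L, ∀ y ∈ X, H.Adj x y → y ∉ L ∧ F.Adj (e x) (f y) := by
    intro x hx y hy hxy
    obtain ⟨h1, h2⟩ := hparL x hx
    obtain rfl := h2 y hy hxy
    refine ⟨(Finset.mem_sdiff.1 h1).2, ?_⟩
    have h3 := hfA _ h1
    have h4 : A (par x) = AY := if_pos (Finset.mem_image_of_mem par hx)
    rw [h4] at h3
    obtain ⟨h5, h6⟩ := Finset.mem_sdiff.1 (hAY h3)
    by_contra hcon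
    refine h6 (Finset.mem_biUnion.2 ⟨e x, heR x hx, Finset.mem_filter.2 ⟨h5,
      (SimpleGraph.compl_adj _ _ _).2 ⟨fun h => ?_, hcon⟩⟩⟩)
    exact Finset.disjoint_left.1 hPR h5 (h ▸ heR x hx)
  refine ⟨fun x => if x ∈ L then e x else f x, ?_, ?_⟩
  · intro a ha b hb hab
    rw [Finset.mem_coe] at ha hb
    simp only at hab
    split_ifs at hab with h1 h2 h2
    · exact he.1 h1 h2 hab
    · exact absurd (hab ▸ heR a h1) (Finset.disjoint_left.1 hPR (hfP b hb h2))
    · exact absurd (hab ▸ heR b h2) (Finset.disjoint_left.1 hPR (hfP a ha h1))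
    · exact hf.1 (Finset.mem_sdiff.2 ⟨ha, h1⟩) (Finset.mem_sdiff.2 ⟨hb, h2⟩) hab
  · intro a ha b hb hab
    simp only
    split_ifs with h1 h2 h2
    · exact absurd h2 (hedge a h1 b hb hab).1
    · exact (hedge a h1 b hb hab).2
    · exact (hedge b h2 a ha hab.symm).2.symm
    · exact hf.2 a (Finset.mem_sdiff.2 ⟨ha, h1⟩) b (Finset.mem_sdiff.2 ⟨hb, h2⟩) hab

/-- Embedding when some vertex has degree at least `n` in the complement. -/
lemma exists_partialEmb_of_large_compl_degree [Fintype W] {F : SimpleGraph W} {k n l : ℕ}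
    (hk : 5 ≤ k) (hodd : Odd k) (hB : NoCycleSeq Fᶜ k) (hn : 1833 * k ^ 4 ≤ n)
    (hl : 117 * k ^ 2 * l ≤ n) (hW : Fintype.card W + 1 = 2 * n) {v : W} {S : Finset W}
    (hv : ∀ a ∈ S, Fᶜ.Adj v a) (hSn : S.card = n) {H : SimpleGraph V} {X : Finset V}
    (hX : CutConnected H X) (hsum : ∑ x ∈ X, degIn H X x ≤ 2 * (X.card + l)) (hXn : X.card = n) :
    ∃ f, PartialEmb H F X f := by
  have : Nonempty W := ⟨v⟩
  -- Blue degrees inside `S` average less than `2 * k`, so at most `n / (30 * k)` vertices exceed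
  -- `D`.
  obtain ⟨D, hD⟩ : ∃ D, D = 60 * k ^ 2 := ⟨_, rfl⟩
  set S0 := S.filter (fun u => degIn Fᶜ S u ≤ D) with hS0
  set T := S.filter (fun u => ¬ degIn Fᶜ S u ≤ D) with hT
  have hS0S : S0 ⊆ S := Finset.filter_subset _ _
  have hS0D : ∀ u ∈ S0, degIn Fᶜ S u ≤ D := fun u hu => (Finset.mem_filter.1 hu).2
  have hST : S0.card + T.card = n := hSn ▸ Finset.card_filter_add_card_filter_not _
  have hdeg : ∀ A ⊆ S, A.Nonempty → ∃ x ∈ A, degIn Fᶜ A x < k - 2 := fun A hA hne =>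
    hB.exists_degIn_lt (by omega) (fun a ha => hv a (hA ha)) hne
  have hTcard : 30 * (k * T.card) ≤ n := by
    have h1 := sum_degIn_le_of_degenerate Fᶜ (k - 3) S fun A hA hne => by
      obtain ⟨x, hx, hxd⟩ := hdeg A hA hne
      exact ⟨x, hx, by omega⟩
    have h2 : T.card * (D + 1) ≤ ∑ x ∈ T, degIn Fᶜ S x := by
      rw [← smul_eq_mul]
      refine Finset.card_nsmul_le_sum _ _ _ fun x hx => ?_
      have := (Finset.mem_filter.1 hx).2
      omega
    have h3 : ∑ x ∈ T, degIn Fᶜ S x ≤ ∑ x ∈ S, degIn Fᶜ S x :=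
      Finset.sum_le_sum_of_subset (Finset.filter_subset _ _)
    have h4 : 2 * (k - 3) * S.card ≤ 2 * k * n := by
      rw [hSn]
      exact Nat.mul_le_mul_right _ (by omega)
    have h5 : (2 * k) * (30 * (k * T.card)) ≤ (2 * k) * n := by
      have h6 : (2 * k) * (30 * (k * T.card)) = T.card * D := by
        rw [hD]
        ring
      rw [h6]
      nlinarith
    exact Nat.le_of_mul_le_mul_left h5 (by omega)
  have h5T : 5 * T.card ≤ k * T.card := Nat.mul_le_mul_right _ hk
  have h5l : 5 * (k * l) ≤ k * (k * l) := Nat.mul_le_mul_right _ hk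
  have h1l : 5 * l ≤ k * l := Nat.mul_le_mul_right _ hk
  have hl' : 117 * (k * (k * l)) ≤ n := le_trans (le_of_eq (by ring)) hl
  have h5D : 5 * D ≤ k * D := Nat.mul_le_mul_right _ hk
  have hkD : 152 * (k * D) ≤ n := by
    rw [hD]
    have : 5 * k ^ 3 ≤ k * k ^ 3 := Nat.mul_le_mul_right _ hk
    nlinarith
  have hkk : 60 * k ≤ D := by
    rw [hD]
    nlinarith
  have hclique : ∀ A ⊆ S, ∃ K ⊆ A, A.card ≤ (k - 2) * K.card ∧
      ∀ a ∈ K, ∀ b ∈ K, a ≠ b → F.Adj a b := fun A hA =>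
    exists_clique_of_degenerate F (k - 2) A fun A' hA' => hdeg A' (hA'.trans hA)
  have hcl2 : ∀ A K : Finset W, A.card ≤ (k - 2) * K.card → 2 * (k * l) ≤ A.card →
      2 * l ≤ K.card := by
    intro A K h1 h2
    by_contra hcon
    push Not at hcon
    have h3 : (k - 2) * (K.card + 1) ≤ (k - 2) * (2 * l) := Nat.mul_le_mul_left _ hcon
    have h4 : (k - 2) * (2 * l) ≤ k * (2 * l) := Nat.mul_le_mul_right _ (by omega)
    have h5 : k * (2 * l) = 2 * (k * l) := by ring
    rw [Nat.mul_succ] at h3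
    omega
  -- This many leaves suffice for `exists_partialEmb_of_many_leaves` and for filling `R` at the end;
  -- with fewer, `3 * k * (2 * q + 3 * l)` still fits into `S0`.
  obtain ⟨q, hq⟩ : ∃ q, q = T.card + 2 * (k * l) + 5 * D + 1 := ⟨_, rfl⟩
  rcases Nat.lt_or_ge (X.filter (fun x => degIn H X x = 1)).card q with hfew | hmany
  · obtain ⟨K, hKS, hKcard, hK⟩ := hclique S0 hS0S
    refine exists_partialEmb_of_few_leaves (k := k) (n := n) (l := l) (S := S0) (D := D)
      (M := S0.card - 2 * D) (q := q) (by omega) hodd hB (by omega) (by omega)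
      (fun u hu => (degIn_mono hS0S u).trans (hS0D u hu)) hKS hK (hcl2 _ _ hKcard (by omega))
      (by omega) (by omega) ?_ H X hX hsum hXn.le hfew.le
    have : 3 * k * (2 * q + 3 * l) =
        6 * (k * T.card) + 12 * (k * (k * l)) + 30 * (k * D) + 6 * k + 9 * (k * l) := by
      rw [hq]
      ring
    omega
  set Q0 := S0.filter (fun u => n ≤ degIn F Finset.univ u + 1) with hQ0
  have hQ0S : Q0 ⊆ S0 := Finset.filter_subset _ _
  rcases Nat.lt_or_ge Q0.card (2 * (k * l) + 3 * D + 1) with hQsmall | hQbig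
  swap
  · obtain ⟨K, hKQ, hKcard, hK⟩ := hclique Q0 (hQ0S.trans hS0S)
    obtain ⟨K', hK'K, hK'card⟩ :=
      Finset.exists_subset_card_eq (hcl2 Q0 K hKcard (by omega))
    obtain ⟨Q, hK'Q, hQQ0, hQcard⟩ := Finset.exists_subsuperset_card_eq (hK'K.trans hKQ)
      (show K'.card ≤ 3 * D + 2 * l + 1 by omega) (by omega)
    exact exists_partialEmb_of_many_leaves hS0S hSn hS0D (hQQ0.trans hQ0S)
      (fun u hu => (Finset.mem_filter.1 (hQQ0 hu)).2) hK'Q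
      (fun a ha b hb => hK a (hK'K ha) b (hK'K hb)) hK'card hQcard hX hsum hXn (by omega)
      (by omega)
  set P := S0 \ Q0 with hP
  have hPS0 : P ⊆ S0 := Finset.sdiff_subset
  have hPcard : P.card + Q0.card = S0.card := Finset.card_sdiff_add_card_eq_card hQ0S
  set C := Finset.univ \ S with hC
  have hCcard : C.card + S.card = Fintype.card W := by
    rw [hC, Finset.card_sdiff_add_card_eq_card (Finset.subset_univ S), Finset.card_univ]
  have hPC : Disjoint P C := Finset.disjoint_sdiff.mono_left (hPS0.trans hS0S)
  -- Vertices of `P` have red degree at most `n - 2`, hence blue degree at least `n`, of which at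
  -- most `D` falls in `S`.
  have hPblue : ∀ u ∈ P, n ≤ degIn Fᶜ C u + D := by
    intro u hu
    obtain ⟨hu0, huQ⟩ := Finset.mem_sdiff.1 hu
    have h1 : ¬ n ≤ degIn F Finset.univ u + 1 := fun h => huQ (Finset.mem_filter.2 ⟨hu0, h⟩)
    have h2 := card_le_degIn_add_degIn_compl F (Finset.mem_univ u)
    have h3 := hS0D u hu0
    have h4 := degIn_le_add_sdiff Fᶜ Finset.univ S u
    rw [← hC] at h4
    rw [Finset.card_univ] at h2
    omega
  have hcommon : ∀ (B : SimpleGraph W), (∀ u ∈ P, n ≤ degIn B C u + D) → ∀ a ∈ P, ∀ a' ∈ P,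
      k ≤ (C.filter (fun c => B.Adj a c ∧ B.Adj a' c)).card := by
    intro B hB' a ha a' ha'
    have h1 := hB' a ha
    have h2 := hB' a' ha'
    have h3 := Finset.card_union_add_card_inter (C.filter (fun c => B.Adj a c))
      (C.filter (fun c => B.Adj a' c))
    have h4 : (C.filter (fun c => B.Adj a c) ∪ C.filter (fun c => B.Adj a' c)).card ≤ C.card :=
      Finset.card_le_card (Finset.union_subset (Finset.filter_subset _ _)
        (Finset.filter_subset _ _))
    rw [← Finset.filter_and] at h3
    simp only [degIn] at h1 h2
    omega
  have hPclique : ∀ a ∈ P, ∀ b ∈ P, a ≠ b → F.Adj a b := by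
    intro a ha b hb hab
    by_contra hcon
    refine hB.not_adj_of_common (by omega) hodd P C hPC (by omega) ?_ a ha b hb
      ((SimpleGraph.compl_adj _ _ _).2 ⟨hab, hcon⟩)
    exact hcommon Fᶜ hPblue
  set Z := Finset.univ.filter (fun x => 2 ≤ degIn Fᶜ P x) with hZ
  have hZP : ∀ x ∈ Z, x ∉ P := by
    intro x hx hxP
    obtain ⟨y, hy, hxy⟩ := exists_adj_of_degIn_pos
      (lt_of_lt_of_le Nat.zero_lt_two (Finset.mem_filter.1 hx).2)
    rw [SimpleGraph.compl_adj] at hxy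
    exact hxy.2 (hPclique x hxP y hy hxy.1)
  have hZclique : ∀ a ∈ Z, ∀ b ∈ Z, a ≠ b → F.Adj a b := by
    intro a ha b hb hab
    by_contra hcon
    refine hB.not_adj_of_two_neighbors hk hodd P C hPC (by omega) ?_ (hZP a ha) (hZP b hb)
      (Finset.mem_filter.1 ha).2 (Finset.mem_filter.1 hb).2
      ((SimpleGraph.compl_adj _ _ _).2 ⟨hab, hcon⟩)
    exact hcommon Fᶜ hPblue
  rcases Nat.lt_or_ge Z.card n with hZsmall | hZbig
  swap
  · obtain ⟨f, hf, -⟩ := exists_partialEmb_of_clique H F hZclique (X := X) (by omega)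
    exact ⟨f, hf⟩
  have hrest : n - P.card ≤ ((Finset.univ \ Z) \ P).card := by
    have h1 := Finset.le_card_sdiff Z Finset.univ
    have h2 := Finset.le_card_sdiff P (Finset.univ \ Z)
    rw [Finset.card_univ] at h1
    omega
  obtain ⟨R, hR, hRcard⟩ := Finset.exists_subset_card_eq hrest
  refine exists_partialEmb_of_clique_add hPclique (Finset.disjoint_sdiff.mono_right hR) ?_
    (by omega : P.card + R.card = n) (by omega) hX hXn (by omega) (by omega)
  intro r hr
  have h1 := (Finset.mem_sdiff.1 (Finset.mem_sdiff.1 (hR hr)).1).2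
  rw [hZ, Finset.mem_filter] at h1
  have h2 : ¬ 2 ≤ degIn Fᶜ P r := fun h => h1 ⟨Finset.mem_univ r, h⟩
  omega

/-! ### The upper bound, by the maximum blue degree -/

/-- A host on `2n - 1` vertices whose complement has no odd cycle `C_k` contains every sparse
connected graph on `n` vertices. -/
theorem exists_partialEmb_of_noCycleSeq [Fintype W] {F : SimpleGraph W} {k n l : ℕ}
    (hk : 3 ≤ k) (hodd : Odd k) (hB : NoCycleSeq Fᶜ k) (hn : 1833 * k ^ 4 ≤ n)
    (hl : 117 * k ^ 2 * l ≤ n) (hl1 : 1 ≤ l) (hW : Fintype.card W + 1 = 2 * n)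
    {H : SimpleGraph V} {X : Finset V} (hX : CutConnected H X)
    (hsum : ∑ x ∈ X, degIn H X x ≤ 2 * (X.card + l)) (hXn : X.card = n) :
    ∃ f, PartialEmb H F X f := by
  have hk4 : 27 * k ≤ k ^ 4 := by
    have : 3 ^ 3 ≤ k ^ 3 := Nat.pow_le_pow_left hk 3
    nlinarith
  have hWpos : 0 < Fintype.card W := by omega
  have : Nonempty W := Fintype.card_pos_iff.1 hWpos
  obtain ⟨v, -, hv⟩ := Finset.exists_max_image Finset.univ (degIn Fᶜ Finset.univ)
    Finset.univ_nonempty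
  obtain ⟨Δ, hΔ⟩ : ∃ Δ, Δ = degIn Fᶜ Finset.univ v := ⟨_, rfl⟩
  rw [← hΔ] at hv
  obtain ⟨N, hN, hNv⟩ := exists_card_eq_degIn Fᶜ Finset.univ v
  rw [← hΔ] at hN
  obtain ⟨K, hKN, hKcard, hK⟩ := exists_clique_of_degenerate F (k - 2) N fun A hA hne =>
    hB.exists_degIn_lt hk (fun a ha => hNv a (hA ha)) hne
  have hkl : 3 * (k * l) ≤ k * (k * l) := Nat.mul_le_mul_right _ hk
  have hl' : 117 * (k * (k * l)) ≤ n := le_trans (le_of_eq (by ring)) hl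
  rcases Nat.lt_or_ge Δ n with hΔn | hΔn
  · rcases Nat.lt_or_ge (n - 1) (2 * Δ) with h2Δ | h2Δ
    · have hbig : ∀ m, 2 * (k * m) < n → m ≤ K.card := by
        intro m hm
        by_contra hcon
        push Not at hcon
        have h3 : (k - 2) * K.card ≤ k * m := Nat.mul_le_mul (by omega) hcon.le
        omega
      refine exists_partialEmb_of_minDegree (n := n) hk hodd hB (by omega) (by omega) ?_ hK
        (hbig _ ?_) (hbig _ ?_) H X hX hsum hXn.le
      · intro w
        have h1 := card_le_degIn_add_degIn_compl F (Finset.mem_univ w)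
        have h2 := hv w (Finset.mem_univ w)
        rw [Finset.card_univ] at h1
        omega
      · have : k * (3 * k * (3 * l)) = 9 * (k * (k * l)) := by ring
        have : 0 < k * (k * l) := by positivity
        omega
      · have : k ^ 2 * 1 ≤ k ^ 2 * k ^ 2 := Nat.mul_le_mul_left _ (Nat.one_le_pow _ _ (by omega))
        nlinarith
    · rcases Nat.eq_zero_or_pos Δ with h0 | hpos
      · obtain ⟨f, hf, -⟩ := exists_partialEmb_of_clique H F (X := X) (K := Finset.univ)
          (by
            intro a _ b _ hab
            by_contra hcon
            have h1 := hv a (Finset.mem_univ a)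
            have h2 := degIn_pos_of_adj (Finset.mem_univ b)
              ((SimpleGraph.compl_adj F a b).2 ⟨hab, hcon⟩)
            omega)
          (by rw [Finset.card_univ]; omega)
        exact ⟨f, hf⟩
      -- The largest `d` for which fewer than `n` used and at most `d * Δ ≤ n - 1` blocked vertices
      -- leave one of the `2 * n - 1` free. A core larger than `K` would give `n ≤ (d + 1) * Δ ≤ 6 *
      -- k * l`, which is too small.
      obtain ⟨d, hd⟩ : ∃ d, d = (n - 1) / Δ := ⟨_, rfl⟩
      have hd1 : d * Δ ≤ n - 1 := hd ▸ Nat.div_mul_le_self _ _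
      have hd2 : 2 ≤ d := by
        rw [hd, Nat.le_div_iff_mul_le hpos]
        exact h2Δ
      have hd3 : n - 1 < (d + 1) * Δ := by
        rw [hd, Nat.mul_comm]
        exact Nat.lt_mul_div_succ _ hpos
      obtain ⟨f, hf, -⟩ := exists_partialEmb_of_lists H F d Δ (fun _ => Finset.univ) hK X
        (fun _ _ => Finset.subset_univ K)
        (fun X' hX' hmin => by
          have h1 := hX.card_core_le hsum X' hX' hmin
          by_contra hcon
          push Not at hcon
          obtain ⟨e, rfl⟩ : ∃ e, d = e + 1 := ⟨d - 1, by omega⟩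
          rw [Nat.add_sub_cancel] at h1
          have h2 : (e + 1 + 1) * Δ ≤ (3 * e) * ((k - 2) * K.card) :=
            Nat.mul_le_mul (by omega) (hN ▸ hKcard)
          have h3 : e * K.card ≤ 2 * l := (Nat.mul_le_mul_left _ hcon.le).trans h1
          have h4 : (3 * e) * ((k - 2) * K.card) = 3 * ((k - 2) * (e * K.card)) := by ring
          have h5 : (k - 2) * (e * K.card) ≤ k * (2 * l) := Nat.mul_le_mul (by omega) h3
          have h6 : k * (2 * l) = 2 * (k * l) := by ring
          have h7 : 0 < k * l := by positivity
          omega)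
        (fun _ _ _ _ u _ => hv u (Finset.mem_univ u))
        (fun X' hX' x hx hxX' f _ _ => by
          have h2 := Finset.card_image_le (s := X') (f := f)
          have h3 := Finset.card_lt_card (Finset.ssubset_iff_subset_ne.2
            ⟨hX', fun h => hxX' (h ▸ hx)⟩)
          rw [Finset.inter_univ, Finset.card_univ]
          omega)
      exact ⟨f, hf⟩
  · rcases Nat.lt_or_ge k 5 with hk5 | hk5
    -- Here the factor `k - 2` is `1`, so `K` already has at least `n` vertices.
    · obtain rfl : k = 3 := by
        obtain ⟨j, rfl⟩ := hodd
        omega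
      obtain ⟨f, hf, -⟩ := exists_partialEmb_of_clique H F hK (X := X) (by omega)
      exact ⟨f, hf⟩
    · obtain ⟨S, hSN, hScard⟩ := Finset.exists_subset_card_eq (show n ≤ N.card by omega)
      exact exists_partialEmb_of_large_compl_degree hk5 hodd hB hn hl hW
        (fun a ha => hNv a (hSN ha)) hScard hX hsum hXn

/-! ### The lower bound and the conclusion -/

lemma SimpleGraph.Connected.cutConnected_univ [Fintype V] {G : SimpleGraph V} (h : G.Connected) :
    CutConnected G Finset.univ := by
  intro A _ ⟨a, ha⟩ hne
  obtain ⟨b, hb⟩ : ∃ b, b ∉ A := by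
    by_contra hcon
    push Not at hcon
    exact hne (Finset.eq_univ_iff_forall.2 hcon)
  obtain ⟨p⟩ := h.preconnected a b
  obtain ⟨d, -, hd1, hd2⟩ := p.exists_boundary_dart (A : Set V) ha hb
  exact ⟨d.fst, hd1, d.snd, Finset.mem_univ _, hd2, d.adj⟩

lemma sum_degIn_univ [Fintype V] (G : SimpleGraph V) :
    ∑ x, degIn G Finset.univ x = 2 * G.edgeSet.ncard := by
  have h1 := G.sum_degrees_eq_twice_card_edges
  rw [← SimpleGraph.coe_edgeFinset, Set.ncard_coe_finset, ← h1]
  refine Finset.sum_congr rfl fun x _ => ?_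
  rw [← SimpleGraph.card_neighborFinset_eq_degree, SimpleGraph.neighborFinset_eq_filter]
  rfl

/-- Two disjoint cliques covering `Fin N`, the first one on the vertices below `m`. -/
def twoCliques (N m : ℕ) : SimpleGraph (Fin N) where
  Adj i j := i ≠ j ∧ ((i : ℕ) < m ↔ (j : ℕ) < m)
  symm := ⟨fun _ _ h => ⟨h.1.symm, h.2.symm⟩⟩
  loopless := ⟨fun _ h => h.1 rfl⟩

lemma twoCliques_compl_colorable (N m : ℕ) : (twoCliques N m)ᶜ.Colorable 2 := by
  refine ⟨SimpleGraph.Coloring.mk (fun i => if (i : ℕ) < m then (0 : Fin 2) else 1) ?_⟩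
  intro i j hij h
  rw [SimpleGraph.compl_adj] at hij
  refine hij.2 ⟨hij.1, ?_⟩
  split_ifs at h with h1 h2 h2
  · exact iff_of_true h1 h2
  · exact absurd h (by decide)
  · exact absurd h (by decide)
  · exact iff_of_false h1 h2

/-- Connectedness keeps the image inside one clique, and both have fewer vertices than `G`. -/
lemma not_isContained_twoCliques [Fintype V] {G : SimpleGraph V} (hconn : G.Connected) {N m : ℕ}
    (hm : m < Fintype.card V) (hN : N < Fintype.card V + m) :
    ¬ G.IsContained (twoCliques N m) := by
  rintro ⟨f⟩
  obtain ⟨v0⟩ := hconn.nonempty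
  have hside : ∀ v, ((f v0 : ℕ) < m ↔ (f v : ℕ) < m) := by
    intro v
    obtain ⟨p⟩ := hconn.preconnected v0 v
    induction p with
    | nil => rfl
    | cons h _ ih => exact (f.toHom.map_adj h).2.trans ih
  have hinj : Function.Injective fun v => (f v : ℕ) := fun a b h => f.injective (Fin.ext h)
  by_cases h0 : (f v0 : ℕ) < m
  · have := Finset.card_le_card_of_injOn (s := Finset.univ) (t := Finset.range m)
      (fun v => (f v : ℕ)) (fun v _ => Finset.mem_coe.2 (Finset.mem_range.2 ((hside v).1 h0)))
      hinj.injOn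
    rw [Finset.card_univ, Finset.card_range] at this
    omega
  · have := Finset.card_le_card_of_injOn (s := Finset.univ) (t := Finset.Ico m N)
      (fun v => (f v : ℕ)) (fun v _ => Finset.mem_coe.2 (Finset.mem_Ico.2
        ⟨Nat.le_of_not_lt fun h => h0 ((hside v).2 h), (f v).2⟩))
      hinj.injOn
    rw [Finset.card_univ, Nat.card_Ico] at this
    omega

lemma not_isContained_cycleGraph_of_colorable {B : SimpleGraph W} (hB : B.Colorable 2) {k : ℕ}
    (hk : 3 ≤ k) (hodd : Odd k) : ¬ (SimpleGraph.cycleGraph k).IsContained B := by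
  rintro ⟨f⟩
  have h1 : (SimpleGraph.cycleGraph k).Colorable 2 := hB.of_hom f.toHom
  have h2 := h1.chromaticNumber_le
  rw [SimpleGraph.chromaticNumber_cycleGraph_of_odd k (by omega) hodd] at h2
  exact absurd h2 (by decide)

end

theorem mainTheorem2 {V : Type*} [Finite V] (G : SimpleGraph V) (n k : ℕ)
    (hconn : G.Connected) (hn : Nat.card V = n)
    (hedges : (G.edgeSet.ncard : ℝ) ≤ (1 + 1 / (117 * (k : ℝ) ^ 2)) * (n : ℝ))
    (hodd : Odd k) (hk : 3 ≤ k) (hnk : 1833 * k ^ 4 ≤ n) :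
    ramseyNumber G (SimpleGraph.cycleGraph k) = 2 * n - 1 := by
  classical
  have := Fintype.ofFinite V
  rw [Nat.card_eq_fintype_card] at hn
  have hk2 : 0 < 117 * k ^ 2 := by positivity
  have hn9 : 117 * k ^ 2 ≤ n := by
    have : 1 ≤ k ^ 2 := Nat.one_le_pow _ _ (by omega)
    nlinarith
  -- The excess of edges over `n` is an integer, so the real bound may be rounded down.
  obtain ⟨l, hl⟩ : ∃ l, l = n / (117 * k ^ 2) := ⟨_, rfl⟩
  have hl1 : 1 ≤ l := by
    rw [hl, Nat.le_div_iff_mul_le hk2]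
    omega
  have hln : 117 * k ^ 2 * l ≤ n := hl ▸ Nat.mul_div_le _ _
  have he : G.edgeSet.ncard ≤ n + l := by
    have h1 : ((G.edgeSet.ncard - n : ℕ) : ℝ) * (117 * (k : ℝ) ^ 2) ≤ n := by
      have hkR : (0 : ℝ) < 117 * (k : ℝ) ^ 2 := by positivity
      rcases Nat.le_total G.edgeSet.ncard n with h | h
      · rw [Nat.sub_eq_zero_of_le h]
        simp
      · rw [Nat.cast_sub h, ← le_div_iff₀ hkR]
        have : (1 + 1 / (117 * (k : ℝ) ^ 2)) * (n : ℝ) = n + n / (117 * (k : ℝ) ^ 2) := by ring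
        linarith
    have h2 : G.edgeSet.ncard - n ≤ l := by
      rw [hl, Nat.le_div_iff_mul_le hk2]
      exact_mod_cast h1
    omega
  have hmem : 2 * n - 1 ∈ {N : ℕ | 0 < N ∧ ∀ F : SimpleGraph (Fin N),
      G.IsContained F ∨ (SimpleGraph.cycleGraph k).IsContained Fᶜ} := by
    refine ⟨by omega, fun F => ?_⟩
    by_contra hcon
    rw [not_or] at hcon
    obtain ⟨f, hf⟩ := exists_partialEmb_of_noCycleSeq hk hodd
      (noCycleSeq_of_not_isContained hk hcon.2) hnk hln hl1
      (by rw [Fintype.card_fin]; omega) hconn.cutConnected_univ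
      (by rw [sum_degIn_univ, Finset.card_univ, hn]; omega) (by rw [Finset.card_univ, hn])
    refine hcon.1 ⟨⟨⟨f, fun {a b} hab => hf.2 a (Finset.mem_univ a) b (Finset.mem_univ b) hab⟩,
      fun a b hab => hf.1 (by simp) (by simp) hab⟩⟩
  refine le_antisymm (Nat.sInf_le hmem) (le_csInf ⟨_, hmem⟩ ?_)
  rintro N ⟨-, hN⟩
  by_contra hlt
  rcases hN (twoCliques N (n - 1)) with h | h
  · exact not_isContained_twoCliques hconn (by omega) (by omega) h
  · exact not_isContained_cycleGraph_of_colorable (twoCliques_compl_colorable _ _) hk hodd h
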